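/- **Setting.** Let $G$ be a diffeological group, $\mathbb Z_2=\{\pm1\}$ (discrete), $\sigma:\mathbb Z_2\to\operatorname{Aut}(G)$ an action by smooth automorphisms, and $H_\sigma=G\rtimes_\sigma\mathbb Z_2$. Let $1\to U(1)\to\widehat G\xrightarrow{q}G\to1$ be a central extension of diffeological groups ($U(1)\to\widehat G$ is an induction, $q$ a subduction) and $\widehat\sigma:\mathbb Z_2\to\operatorname{Aut}(\widehat G)$ an action by smooth automorphisms with $q\circ\widehat\sigma^{\varepsilon}=\sigma^\varepsilon\circ q$. Then $\mathbb Z_2$ acts on $U(1)$ by $z\mapsto z^{\chi(\varepsilon)}$ for a character $\chi:\mathbb Z_2\to\{\pm1\}$, and it acts on $\mathbb R$ and $\mathbb Z$ through $\chi$. $E^{\mathrm{sph}}(G)$ is the set of sequences $(x_i,g_i)_{i\in\mathbb N}$ with $x_i\in\mathbb R$ finitely supported, $\sum x_i^2=1$, $g_i\in G$, modulo $(x_i,g_i)\sim(x_i,g_i')$ iff $g_i=g_i'$ whenever $x_i\ne0$, with the final diffeology of the maps $S_I\times G^I\to E^{\mathrm{sph}}(G)$, where $I\subset\mathbb N$ is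 finite and $S_I\subset\mathbb R^I$ is the unit sphere. The group $H_\sigma$ acts by $(h,\varepsilon)\cdot[(x_i,g_i)]=[(\varepsilon x_i,h\,\sigma^\varepsilon(g_i))]$, and $B^{\mathrm{sph}}_\sigma(G)=E^{\mathrm{sph}}(G)/H_\sigma$ has the quotient diffeology. Then $E^{\mathrm{sph}}(G)\to B^{\mathrm{sph}}_\sigma(G)$ is a diffeological principal $H_\sigma$-bundle, the universal bundle (principal groups act from the left). **Cohomology.** For a diffeological space $X$, consider the category of Euclidean plots $p:\mathbb R^n\to X$, $n\ge0$, a morphism $\varphi:p\to p'$ being a smooth map with $p'\circ\varphi=p$. For a presheaf $F$ of abelian groups on it, $H^k(X;F)$ is the cohomology of the Čech-type complex whose $k$-cochains assign to each chain $p_0\to\cdots\to p_k$ an element of $F(p_0)$. For a principal $H_\sigma$-bundle $P\to X$ and $M=\mathbb Z,\mathbb R,U(1)$, the local system $M_{\alpha(P)}$ assigns to $p$ the smooth maps $m:p^*P\to M$ with $m((g,\varepsilon)\cdot y)=\chi(\varepsilon)\cdot m(y)$. **Twisting data.** Choose smooth sections $s_p:\mathbb R^n\to P$ of $P$ over all Euclidean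 plots $p$, with transition functions $h_\varphi=(g_\varphi,\varepsilon_\varphi)$ defined by $s_p=h_\varphi\cdot(s_{p'}\circ\varphi)$ for $\varphi:p\to p'$, and smooth lifts $\widehat g_\varphi$ of $g_\varphi$ to $\widehat G$. Set * $\alpha(P)=[\varepsilon_\varphi]\in H^1(X;\mathbb Z_2)$; * $\beta(P)=[a]\in H^2(X;U(1)_{\alpha(P)})$, where for $p\xrightarrow{\varphi}p'\xrightarrow{\psi}p''$ the section $a_{\varphi,\psi}$ takes at $s_p$ the value $\widehat g_\varphi\,\widehat\sigma^{\varepsilon_\varphi}(\widehat g_\psi\circ\varphi)\,\widehat g_{\psi\circ\varphi}^{-1}\in U(1)$; * $\operatorname{DD}_\alpha(P)\in H^3(X;\mathbb Z_{\alpha(P)})$, the image of $\beta(P)$ under the connecting morphism of $0\to\mathbb Z_{\alpha(P)}\to\mathbb R_{\alpha(P)}\to U(1)_{\alpha(P)}\to0$ (the second map being $t\mapsto e^{2\pi i t}$). The spherical twisting datum of $P$ is $\tau(P)=(\alpha(P),\operatorname{DD}_\alpha(P))$, and $\tau_{\mathrm{univ}}=(\alpha_{\mathrm{univ}},\operatorname{DD}_{\mathrm{univ}})$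 is that of the universal bundle. **Theorem.** Let $P\to X$ be a diffeological principal $H_\sigma$-bundle over a diffeological space, classified by $f_P$: that is, $f_P:X\to B^{\mathrm{sph}}_\sigma(G)$ is smooth and $\Phi:P\cong f_P^*E^{\mathrm{sph}}(G)$ is an isomorphism of principal bundles. Then $\tau_{\mathrm{univ}}$ and $\tau(P)$ are well defined (they exist and do not depend on the choices made), and $$\tau(P)=f_P^*(\tau_{\mathrm{univ}}),$$ that is, $\alpha(P)=f_P^*\alpha_{\mathrm{univ}}$ in $H^1(X;\mathbb Z_2)$ and $\operatorname{DD}_\alpha(P)=f_P^*\operatorname{DD}_{\mathrm{univ}}$ in $H^3(X;\mathbb Z_{\alpha(P)})$, where $f_P^*\mathbb Z_{\alpha_{\mathrm{univ}}}$ is identified with $\mathbb Z_{\alpha(P)}$ through $\Phi$. -/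

import Mathlib

open Diffeology CategoryTheory Opposite Topology
open scoped ContDiff

noncomputable section

namespace SphericalTwist

universe u v w

/-! ### Diffeologies: initial, product, discrete and final diffeologies -/

/-- Euclidean space `ℝⁿ`. -/
abbrev Euc (n : ℕ) : Type := EuclideanSpace ℝ (Fin n)

lemma isPlot_of_nhds {X : Type*} [DiffeologicalSpace X] {n : ℕ} {p : Euc n → X}
    (h : ∀ x, ∃ q : Euc n → X, IsPlot q ∧ p =ᶠ[𝓝 x] q) : IsPlot p := by
  refine DiffeologicalSpace.locality fun x => ?_
  obtain ⟨q, hq, hpq⟩ := h x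
  obtain ⟨s, hs, hso, hxs⟩ := eventually_nhds_iff.1 hpq
  refine ⟨s, hso, hxs, fun {m f} hf hfs => ?_⟩
  have : p ∘ f = q ∘ f := funext fun y => hs _ (hf y)
  rw [this]
  exact isPlot_reparam hq hfs

/-- A smooth self-map of `ℝⁿ` with values in a given neighbourhood of a point, which is the
identity near that point. -/
lemma exists_smooth_retract {n : ℕ} (x : Euc n) {s : Set (Euc n)} (hs : IsOpen s) (hx : x ∈ s) :
    ∃ f : Euc n → Euc n, ContDiff ℝ ∞ f ∧ (∀ y, f y ∈ s) ∧ f =ᶠ[𝓝 x] id := by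
  obtain ⟨ε, hε, hball⟩ := Metric.isOpen_iff.1 hs x hx
  let b : ContDiffBump x := ⟨ε / 2, ε, by positivity, by linarith⟩
  refine ⟨fun y => x + b y • (y - x), ?_, fun y => hball ?_, ?_⟩
  · exact contDiff_const.add (b.contDiff.smul (contDiff_id.sub contDiff_const))
  · rw [Metric.mem_ball, dist_eq_norm, add_sub_cancel_left, norm_smul, Real.norm_eq_abs,
      abs_of_nonneg b.nonneg]
    by_cases hy : dist y x < ε
    · rw [dist_eq_norm] at hy
      calc b y * ‖y - x‖ ≤ 1 * ‖y - x‖ := by gcongr; exact b.le_one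
        _ < ε := by simpa using hy
    · have : b y = 0 := b.zero_of_le_dist (by simpa [b] using not_lt.1 hy)
      simpa [this] using hε
  · filter_upwards [b.eventuallyEq_one] with y hy
    simp [hy]

/-- The initial diffeology along a map `f`: `p` is a plot iff `f ∘ p` is one. -/
abbrev inducedDiffeology {X Y : Type*} (f : X → Y) [DiffeologicalSpace Y] : DiffeologicalSpace X where
  plots _ := {p | IsPlot (f ∘ p)}
  constant_plots x := isPlot_const (x := f x)
  plot_reparam hp hf := isPlot_reparam hp hf
  locality h := DiffeologicalSpace.locality (p := f ∘ _) h

instance instSubtype {X : Type*} [DiffeologicalSpace X] (s : X → Prop) :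
    DiffeologicalSpace (Subtype s) := inducedDiffeology Subtype.val

instance instProd {X Y : Type*} [DiffeologicalSpace X] [DiffeologicalSpace Y] :
    DiffeologicalSpace (X × Y) where
  plots _ := {p | IsPlot (fun u => (p u).1) ∧ IsPlot (fun u => (p u).2)}
  constant_plots x := ⟨isPlot_const (x := x.1), isPlot_const (x := x.2)⟩
  plot_reparam hp hf := ⟨isPlot_reparam hp.1 hf, isPlot_reparam hp.2 hf⟩
  locality h :=
    ⟨DiffeologicalSpace.locality fun x =>
        let ⟨s, hs, hx, H⟩ := h x; ⟨s, hs, hx, fun a b => (H a b).1⟩,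
      DiffeologicalSpace.locality fun x =>
        let ⟨s, hs, hx, H⟩ := h x; ⟨s, hs, hx, fun a b => (H a b).2⟩⟩

instance instPi {ι : Type*} {X : ι → Type*} [∀ i, DiffeologicalSpace (X i)] :
    DiffeologicalSpace (∀ i, X i) where
  plots _ := {p | ∀ i, IsPlot (fun u => p u i)}
  constant_plots x := fun i => isPlot_const (x := x i)
  plot_reparam hp hf := fun i => isPlot_reparam (hp i) hf
  locality h := fun i => DiffeologicalSpace.locality fun x =>
    let ⟨s, hs, hx, H⟩ := h x; ⟨s, hs, hx, fun a b => H a b i⟩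

/-- The discrete diffeology: the plots are the locally constant maps. -/
abbrev discreteDiffeology (X : Type*) : DiffeologicalSpace X where
  plots _ := {p | IsLocallyConstant p}
  constant_plots x := IsLocallyConstant.const x
  plot_reparam hp hf := hp.comp_continuous hf.continuous
  locality {n p} h := by
    refine (IsLocallyConstant.iff_eventually_eq p).2 fun x => ?_
    obtain ⟨s, hs, hx, H⟩ := h x
    obtain ⟨f, hf, hfs, hfx⟩ := exists_smooth_retract x hs hx
    have h1 := (IsLocallyConstant.iff_eventually_eq _).1 (H hfs hf) x
    filter_upwards [h1, hfx] with y hy hy'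
    have := hfx.eq_of_nhds
    simp_all

instance instInt : DiffeologicalSpace ℤ := discreteDiffeology ℤ

/-- `ℤ₂ = {±1}` is a discrete diffeological group. -/
instance instUnits : DiffeologicalSpace ℤˣ := discreteDiffeology ℤˣ

/-- `U(1)` carries the subset diffeology of `ℂ`: the plots are the smooth maps to the circle. -/
instance instCircle : DiffeologicalSpace Circle :=
  @inducedDiffeology _ _ (fun z : Circle => (z : ℂ)) (NormedSpace.toDiffeology ℂ)

instance instAdditive {M : Type*} [d : DiffeologicalSpace M] : DiffeologicalSpace (Additive M) := d

/-- The final diffeology of a family of maps: the finest diffeology making all of them smooth. -/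
abbrev finalDiffeology {ι : Type*} {X : ι → Type*} [∀ i, DiffeologicalSpace (X i)] {Y : Type*}
    (f : ∀ i, X i → Y) : DiffeologicalSpace Y :=
  DiffeologicalSpace.generateFrom
    {q | ∃ (i : ι) (p : Euc q.1 → X i), IsPlot p ∧ q.2 = f i ∘ p}

/-- The quotient diffeology: the finest diffeology making the projection smooth. -/
instance instQuotient {X : Type*} [DiffeologicalSpace X] (s : Setoid X) :
    DiffeologicalSpace (Quotient s) :=
  finalDiffeology (fun _ : Unit => (Quotient.mk s : X → Quotient s))

lemma final_smooth {ι : Type*} {X : ι → Type*} [∀ i, DiffeologicalSpace (X i)] {Y : Type*}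
    (f : ∀ i, X i → Y) (i : ι) {n : ℕ} {p : Euc n → X i} (hp : IsPlot p) :
    (@IsPlot _ (finalDiffeology f)) (f i ∘ p) :=
  DiffeologicalSpace.isPlot_generatedFrom_of_mem ⟨i, p, hp, rfl⟩

/-- For a jointly surjective family, the plots of the final diffeology are the maps that locally
lift to a plot of a member of the family. -/
lemma final_locally_lifts {ι : Type*} {X : ι → Type*} [∀ i, DiffeologicalSpace (X i)] {Y : Type*}
    (f : ∀ i, X i → Y) (hf : ∀ y, ∃ i x, f i x = y) {n : ℕ} {q : Euc n → Y}
    (hq : (@IsPlot _ (finalDiffeology f)) q) (x : Euc n) :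
    ∃ (i : ι) (p : Euc n → X i), IsPlot p ∧ q =ᶠ[𝓝 x] f i ∘ p := by
  let d : DiffeologicalSpace Y :=
    { plots := fun n => {q | ∀ x : Euc n, ∃ (i : ι) (p : Euc n → X i),
        IsPlot p ∧ q =ᶠ[𝓝 x] f i ∘ p}
      constant_plots := fun {n} y x => by
        obtain ⟨i, z, hz⟩ := hf y
        exact ⟨i, fun _ => z, isPlot_const, by simp [Function.comp_def, hz]⟩
      plot_reparam := fun {n m p g} hp hg x => by
        obtain ⟨i, r, hr, h⟩ := hp (g x)
        exact ⟨i, r ∘ g, isPlot_reparam hr hg, hg.continuous.continuousAt.eventually h⟩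
      locality := fun {n p} h x => by
        obtain ⟨s, hs, hx, H⟩ := h x
        obtain ⟨g, hg, hgs, hgx⟩ := exists_smooth_retract x hs hx
        obtain ⟨i, r, hr, h'⟩ := H hgs hg x
        refine ⟨i, r, hr, ?_⟩
        filter_upwards [h', hgx] with y hy hy'
        simpa [hy'] using hy }
  have hle : finalDiffeology f ≤ d := by
    refine DiffeologicalSpace.generateFrom_le_iff.2 fun n q hq x => ?_
    obtain ⟨i, p, hp, hqp⟩ := hq
    exact ⟨i, p, hp, Filter.EventuallyEq.of_eq hqp⟩
  exact DiffeologicalSpace.le_iff'.1 hle n q hq x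

/-- A group with a diffeology for which multiplication and inversion are smooth. -/
class DiffeologicalGroup (G : Type*) [Group G] [DiffeologicalSpace G] : Prop where
  smooth_mul : DSmooth fun z : G × G => z.1 * z.2
  smooth_inv : DSmooth fun g : G => g⁻¹

/-- An additive group with a diffeology for which addition and negation are smooth. -/
class DiffeologicalAddGroup (M : Type*) [AddGroup M] [DiffeologicalSpace M] : Prop where
  smooth_add : DSmooth fun z : M × M => z.1 + z.2
  smooth_neg : DSmooth fun m : M => -m

lemma IsPlot.mul' {G : Type*} [Group G] [DiffeologicalSpace G] [DiffeologicalGroup G] {n : ℕ}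
    {p q : Euc n → G} (hp : IsPlot p) (hq : IsPlot q) : IsPlot (fun u => p u * q u) :=
  DiffeologicalGroup.smooth_mul n (fun u => (p u, q u)) ⟨hp, hq⟩

lemma IsPlot.inv' {G : Type*} [Group G] [DiffeologicalSpace G] [DiffeologicalGroup G] {n : ℕ}
    {p : Euc n → G} (hp : IsPlot p) : IsPlot (fun u => (p u)⁻¹) :=
  DiffeologicalGroup.smooth_inv n p hp

instance : DiffeologicalAddGroup ℤ where
  smooth_add _ p hp := by
    have h1 : IsLocallyConstant (fun u => (p u).1) := hp.1
    have h2 : IsLocallyConstant (fun u => (p u).2) := hp.2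
    exact h1.add h2
  smooth_neg _ p hp := by
    have h1 : IsLocallyConstant p := hp
    exact h1.neg

instance : DiffeologicalAddGroup ℝ where
  smooth_add _ p hp := (hp.1.contDiff.add hp.2.contDiff).isPlot
  smooth_neg _ p hp := hp.contDiff.neg.isPlot

lemma isPlot_circle_iff {n : ℕ} {p : Euc n → Circle} :
    IsPlot p ↔ ContDiff ℝ ∞ fun u => (p u : ℂ) := Iff.rfl

instance : DiffeologicalAddGroup (Additive Circle) where
  smooth_add _ p hp := by
    have h1 : ContDiff ℝ ∞ fun u => ((p u).1.toMul : ℂ) := hp.1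
    have h2 : ContDiff ℝ ∞ fun u => ((p u).2.toMul : ℂ) := hp.2
    have h3 : ContDiff ℝ ∞ fun u => ((p u).1.toMul : ℂ) * ((p u).2.toMul : ℂ) := h1.mul h2
    refine (isPlot_circle_iff (p := fun u => (p u).1.toMul * (p u).2.toMul)).2 ?_
    simpa using h3
  smooth_neg _ p hp := by
    have h1 : ContDiff ℝ ∞ fun u => ((p u).toMul : ℂ) := hp
    refine (isPlot_circle_iff (p := fun u => (p u).toMul⁻¹)).2 ?_
    have h2 : ContDiff ℝ ∞ fun u => Complex.conjCLE ((p u).toMul : ℂ) :=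
      Complex.conjCLE.contDiff.comp h1
    simpa only [Circle.coe_inv_eq_conj, Complex.conjCLE_apply] using h2

/-! ### Principal bundles -/

/-- A map is a subduction if it is smooth and surjective and every plot of the target lifts locally
to a plot of the source (that is, the target carries the quotient diffeology). -/
structure IsSubduction {X Y : Type*} [DiffeologicalSpace X] [DiffeologicalSpace Y]
    (f : X → Y) : Prop where
  smooth : DSmooth f
  surjective : Function.Surjective f
  lifts : ∀ (n : ℕ) (p : Euc n → Y), IsPlot p → ∀ x, ∃ q : Euc n → X,
    IsPlot q ∧ p =ᶠ[𝓝 x] f ∘ q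

/-- A diffeological principal `H`-bundle over `X` (the group acting from the left): a smooth action
on the total space such that `(h, y) ↦ (y, h • y)` is a diffeomorphism onto the fibre product over
`X` (`free_transitive` gives bijectivity, `smooth_div` smoothness of the inverse), and such that the
projection is a subduction. -/
structure PrincipalBundle (H : Type u) [Group H] [DiffeologicalSpace H] (X : Type v)
    [DiffeologicalSpace X] where
  Total : Type w
  [diffeology : DiffeologicalSpace Total]
  [action : MulAction H Total]
  proj : Total → X
  subduction : IsSubduction proj
  proj_smul : ∀ (h : H) (y : Total), proj (h • y) = proj y
  smooth_smul : DSmooth fun z : H × Total => z.1 • z.2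
  free_transitive : ∀ y z : Total, proj y = proj z → ∃! h : H, y = h • z
  smooth_div : ∀ (n : ℕ) (h : Euc n → H) (z : Euc n → Total),
    IsPlot z → IsPlot (fun x => h x • z x) → IsPlot h

attribute [instance] PrincipalBundle.diffeology PrincipalBundle.action

namespace PrincipalBundle

variable {H : Type*} [Group H] [DiffeologicalSpace H] {X Y : Type*} [DiffeologicalSpace X]
  [DiffeologicalSpace Y]

/-- The element `h` with `y = h • z`, for two points of the same fibre. -/
def div (P : PrincipalBundle H X) {y z : P.Total} (h : P.proj y = P.proj z) : H :=
  (P.free_transitive y z h).choose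

/-- The total space of the pull-back: the fibre product with its subset diffeology. -/
abbrev PullbackTotal (P : PrincipalBundle H X) (f : Y → X) : Type _ :=
  {z : Y × P.Total // P.proj z.2 = f z.1}

instance (P : PrincipalBundle H X) (f : Y → X) : MulAction H (P.PullbackTotal f) where
  smul h z := ⟨(z.1.1, h • z.1.2), (P.proj_smul h z.1.2).trans z.2⟩
  one_smul z := Subtype.ext (Prod.ext rfl (one_smul H z.1.2))
  mul_smul h k z := Subtype.ext (Prod.ext rfl (mul_smul h k z.1.2))

/-- The pull-back of a principal bundle along a smooth map. -/
def pullback (P : PrincipalBundle H X) (f : Y → X) (hf : DSmooth f) : PrincipalBundle H Y where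
  Total := P.PullbackTotal f
  proj z := z.1.1
  subduction :=
    { smooth := fun _ _ hp => hp.1
      surjective := fun y => by
        obtain ⟨z, hz⟩ := P.subduction.surjective (f y)
        exact ⟨⟨(y, z), hz⟩, rfl⟩
      lifts := fun n p hp x => by
        obtain ⟨q, hq, h⟩ := P.subduction.lifts n _ (hf n p hp) x
        obtain ⟨s, hs, hso, hxs⟩ := eventually_nhds_iff.1 h
        obtain ⟨g, hg, hgs, hgx⟩ := exists_smooth_retract x hso hxs
        refine ⟨fun u => ⟨(p (g u), q (g u)), (hs _ (hgs u)).symm⟩,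
          ⟨isPlot_reparam hp hg, isPlot_reparam hq hg⟩, ?_⟩
        filter_upwards [hgx] with y hy
        simp [hy] }
  proj_smul _ _ := rfl
  smooth_smul n p hp :=
    ⟨hp.2.1, P.smooth_smul n (fun u => ((p u).1, (p u).2.1.2)) ⟨hp.1, hp.2.2⟩⟩
  free_transitive y z h := by
    have h' : P.proj y.1.2 = P.proj z.1.2 := by rw [y.2, z.2]; exact congrArg f h
    obtain ⟨k, hk, hu⟩ := P.free_transitive _ _ h'
    exact ⟨k, Subtype.ext (Prod.ext h hk), fun k' hk' => hu k' (congrArg (fun t => t.1.2) hk')⟩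
  smooth_div n h z hz hhz := P.smooth_div n h _ hz.2 hhz.2

/-- Isomorphisms of principal `H`-bundles over `X`. -/
structure Iso (P Q : PrincipalBundle H X) where
  toEquiv : P.Total ≃ Q.Total
  smooth_toFun : DSmooth toEquiv
  smooth_invFun : DSmooth toEquiv.symm
  proj_comp : ∀ y, Q.proj (toEquiv y) = P.proj y
  equivariant : ∀ (h : H) (y : P.Total), toEquiv (h • y) = h • toEquiv y

end PrincipalBundle

/-! ### The spherical Milnor space and the universal bundle -/

section Milnor

variable (G : Type u) [Group G] [DiffeologicalSpace G]

/-- Labelled sequences `(xᵢ, gᵢ)` with finitely supported `x` and `∑ xᵢ² = 1`. -/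
abbrev PreSph : Type u := {z : (ℕ →₀ ℝ) × (ℕ → G) // (z.1.sum fun _ t => t ^ 2) = 1}

/-- `(xᵢ, gᵢ) ∼ (xᵢ, gᵢ')` iff `gᵢ = gᵢ'` whenever `xᵢ ≠ 0`. -/
def sphSetoid : Setoid (PreSph G) where
  r a b := a.1.1 = b.1.1 ∧ ∀ i, a.1.1 i ≠ 0 → a.1.2 i = b.1.2 i
  iseqv := ⟨fun _ => ⟨rfl, fun _ _ => rfl⟩,
    fun h => ⟨h.1.symm, fun i hi => (h.2 i (h.1 ▸ hi)).symm⟩,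
    fun h k => ⟨h.1.trans k.1, fun i hi => (h.2 i hi).trans (k.2 i (h.1 ▸ hi))⟩⟩

/-- The spherical Milnor space `E^sph(G)`. -/
def ESph : Type u := Quotient (sphSetoid G)

/-- The unit sphere `S_I` of `ℝ^I`, for a finite set `I` of indices. -/
abbrev SphereOn (I : Finset ℕ) : Type := {x : EuclideanSpace ℝ I // ∑ i, x i ^ 2 = 1}

variable {G}

/-- Extension of a finite coordinate vector by zero. -/
def extendZero (I : Finset ℕ) (x : EuclideanSpace ℝ I) : ℕ →₀ ℝ :=
  Finsupp.onFinset I (fun i => if h : i ∈ I then x ⟨i, h⟩ else 0) fun i hi => by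
    by_contra h
    simp [h] at hi

lemma extendZero_sum (I : Finset ℕ) (x : EuclideanSpace ℝ I) :
    ((extendZero I x).sum fun _ t => t ^ 2) = ∑ i, x i ^ 2 := by
  rw [extendZero, Finsupp.onFinset_sum _ (by simp), ← Finset.sum_coe_sort]
  exact Finset.sum_congr rfl fun i _ => by simp

/-- The local model `ψ_I : S_I × G^I → E^sph(G)`. -/
def sphChart (I : Finset ℕ) (z : SphereOn I × (I → G)) : ESph G :=
  Quotient.mk (sphSetoid G)
    ⟨(extendZero I z.1.1, fun i => if h : i ∈ I then z.2 ⟨i, h⟩ else 1),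
      (extendZero_sum I z.1.1).trans z.1.2⟩

/-- `E^sph(G)` carries the final diffeology of the local models `S_I × G^I`, with `I` running over
the finite sets of indices. -/
instance : DiffeologicalSpace (ESph G) := finalDiffeology (fun I : Finset ℕ => sphChart (G := G) I)

lemma sphChart_jointly_surjective (e : ESph G) : ∃ (I : Finset ℕ) (z : _), sphChart (G := G) I z = e := by
  induction e using Quotient.ind with
  | _ a =>
  obtain ⟨⟨x, g⟩, hx⟩ := a
  have hext : extendZero x.support (WithLp.toLp 2 fun i => x i) = x := by
    ext i
    simp only [extendZero, Finsupp.onFinset_apply]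
    split_ifs with h
    · rfl
    · exact (Finsupp.notMem_support_iff.1 h).symm
  refine ⟨x.support, ⟨⟨WithLp.toLp 2 fun i => x i, ?_⟩, fun i => g i⟩, ?_⟩
  · rw [← extendZero_sum, hext]; exact hx
  · refine Quotient.sound ⟨hext, fun i hi => ?_⟩
    have hi' : x i ≠ 0 := by simpa [hext] using hi
    simp [hi']

/-- The semidirect product `H_σ = G ⋊_σ ℤ₂`, with
`(g, ε) (g', ε') = (g σ^ε(g'), ε ε')`. -/
abbrev HGroup (σ : ℤˣ →* MulAut G) : Type u := G ⋊[σ] ℤˣ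

/-- `H_σ` carries the product diffeology. -/
instance (σ : ℤˣ →* MulAut G) : DiffeologicalSpace (HGroup σ) :=
  inducedDiffeology fun h : HGroup σ => (h.left, h.right)

lemma scale_sum (ε : ℤˣ) (x : ℕ →₀ ℝ) :
    (((ε : ℤ) : ℝ) • x).sum (fun _ t => t ^ 2) = x.sum fun _ t => t ^ 2 := by
  rw [Finsupp.sum_smul_index' (by simp)]
  rcases Int.units_eq_one_or ε with rfl | rfl <;> simp

/-- The twisted action on labelled sequences: `(h, ε) · (xᵢ, gᵢ) = (ε xᵢ, h σ^ε(gᵢ))`. -/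
def preAct {σ : ℤˣ →* MulAut G} (h : HGroup σ) (a : PreSph G) : PreSph G :=
  ⟨(((h.right : ℤ) : ℝ) • a.1.1, fun i => h.left * σ h.right (a.1.2 i)),
    (scale_sum h.right a.1.1).trans a.2⟩

/-- The `σ`-twisted action of `H_σ` on `E^sph(G)`. -/
instance (σ : ℤˣ →* MulAut G) : MulAction (HGroup σ) (ESph G) where
  smul h := Quotient.map (sa := sphSetoid G) (sb := sphSetoid G) (preAct h) fun a b hab => by
    refine ⟨by simp [preAct, hab.1], fun i hi => ?_⟩
    have : a.1.1 i ≠ 0 := fun h0 => hi (by simp [preAct, h0])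
    simp [preAct, hab.2 i this]
  one_smul e := by
    induction e using Quotient.ind with
    | _ a => exact congrArg _ (Subtype.ext (Prod.ext (by simp [preAct]) (by ext; simp [preAct])))
  mul_smul h k e := by
    induction e using Quotient.ind with
    | _ a =>
    refine congrArg _ (Subtype.ext (Prod.ext ?_ ?_))
    · ext i; simp [preAct, mul_assoc]
    · ext i; simp [preAct, mul_assoc]

/-- The `σ`-twisted spherical classifying space `B^sph_σ(G) = E^sph(G) / H_σ`. -/
abbrev BSph (σ : ℤˣ →* MulAut G) : Type u :=
  Quotient (MulAction.orbitRel (HGroup σ) (ESph G))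

lemma smul_mk {σ : ℤˣ →* MulAut G} (h : HGroup σ) (a : PreSph G) :
    h • (show ESph G from Quotient.mk (sphSetoid G) a) = Quotient.mk (sphSetoid G) (preAct h a) :=
  rfl

lemma extendZero_apply (I : Finset ℕ) (x : EuclideanSpace ℝ I) (i : ℕ) :
    extendZero I x i = if h : i ∈ I then x ⟨i, h⟩ else 0 := rfl

lemma units_smul_sphere (ε : ℤˣ) {I : Finset ℕ} (x : SphereOn I) :
    ∑ i, ((((ε : ℤ) : ℝ) • x.1 : EuclideanSpace ℝ I) i) ^ 2 = 1 := by
  refine (Finset.sum_congr rfl fun i _ => ?_).trans x.2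
  rcases Int.units_eq_one_or ε with rfl | rfl <;> simp

lemma smul_sphChart {σ : ℤˣ →* MulAut G} (h : HGroup σ) (I : Finset ℕ)
    (z : SphereOn I × (I → G)) :
    h • sphChart I z = sphChart I (⟨((h.right : ℤ) : ℝ) • z.1.1, units_smul_sphere h.right z.1⟩,
      fun i => h.left * σ h.right (z.2 i)) := by
  refine (smul_mk h _).trans (Quotient.sound ⟨?_, fun i hi => ?_⟩)
  · ext i
    simp [preAct, extendZero_apply]
  · by_cases hI : i ∈ I
    · simp [preAct, hI]
    · simp [preAct, extendZero_apply, hI] at hi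

lemma exists_ne_zero {I : Finset ℕ} (x : SphereOn I) : ∃ i, x.1 i ≠ 0 := by
  by_contra! h
  simpa [h] using x.2

/-- The universal principal `H_σ`-bundle `E^sph(G) → B^sph_σ(G)`. -/
def universalBundle [DiffeologicalGroup G] (σ : ℤˣ →* MulAut G) (hσ : ∀ ε, DSmooth (σ ε)) :
    PrincipalBundle (HGroup σ) (BSph σ) where
  Total := ESph G
  proj := Quotient.mk _
  subduction :=
    { smooth := fun _ _ hp => final_smooth _ () hp
      surjective := Quotient.mk_surjective
      lifts := fun _ _ hp x => by
        obtain ⟨_, q, hq, h⟩ :=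
          final_locally_lifts _ (fun y => ⟨(), Quotient.exists_rep y⟩) hp x
        exact ⟨q, hq, h⟩ }
  proj_smul h y := Quotient.sound ⟨h, rfl⟩
  smooth_smul n p hp := by
    refine isPlot_of_nhds fun x => ?_
    obtain ⟨I, r, hr, hpr⟩ := final_locally_lifts _ sphChart_jointly_surjective hp.2 x
    have hl : IsPlot fun u => (p u).1.left := hp.1.1
    have hε : IsLocallyConstant fun u => (p u).1.right := hp.1.2
    obtain ⟨ε, hεdef⟩ : ∃ ε, (p x).1.right = ε := ⟨_, rfl⟩
    refine ⟨sphChart I ∘ fun u => (⟨((ε : ℤ) : ℝ) • (r u).1.1, units_smul_sphere ε (r u).1⟩,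
      fun i => (p u).1.left * σ ε ((r u).2 i)), final_smooth _ I ⟨?_, fun i => ?_⟩, ?_⟩
    · have h1 : IsPlot fun u => (r u).1.1 := hr.1
      exact (h1.contDiff.const_smul ((ε : ℤ) : ℝ)).isPlot
    · exact IsPlot.mul' hl (hσ ε n _ (hr.2 i))
    · filter_upwards [hpr, (IsLocallyConstant.iff_eventually_eq _).1 hε x] with u h1 h2
      simp only [Function.comp_apply] at h1 ⊢
      rw [hεdef] at h2
      rw [h1, smul_sphChart, h2]
  free_transitive y z h := by
    obtain ⟨k, hk⟩ : MulAction.orbitRel (HGroup σ) (ESph G) y z := Quotient.exact h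
    refine ⟨k, hk.symm, fun k' hk' => ?_⟩
    have hkk : k' • z = k • z := hk'.symm.trans hk.symm
    obtain ⟨I, w, rfl⟩ := sphChart_jointly_surjective z
    obtain ⟨i, hi⟩ := exists_ne_zero w.1
    rw [smul_sphChart, smul_sphChart] at hkk
    have hq := Quotient.exact hkk
    have h1 := DFunLike.congr_fun hq.1 i.1
    have h2 := hq.2 i.1
    have hr : k'.right = k.right := by
      simp only [extendZero_apply, Finset.coe_mem, dif_pos, PiLp.smul_apply, smul_eq_mul] at h1
      have h3 := mul_right_cancel₀ hi h1
      exact Units.ext (Int.cast_injective (α := ℝ) h3)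
    have hl := h2 (by
      simp only [extendZero_apply, Finset.coe_mem, dif_pos, PiLp.smul_apply, smul_eq_mul]
      exact mul_ne_zero (by simp) hi)
    simp only [Finset.coe_mem, dif_pos, hr] at hl
    exact SemidirectProduct.ext (mul_right_cancel hl) hr
  smooth_div n h z hz hhz := by
    refine isPlot_of_nhds fun x => ?_
    obtain ⟨I, r, hr, hzr⟩ := final_locally_lifts _ sphChart_jointly_surjective hz x
    obtain ⟨J, s, hs, hzs⟩ := final_locally_lifts _ sphChart_jointly_surjective hhz x
    obtain ⟨i, hi⟩ := exists_ne_zero (r x).1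
    have hrc : ContDiff ℝ ∞ fun u => (r u).1.1 := (show IsPlot fun u => (r u).1.1 from hr.1).contDiff
    have hsc : ContDiff ℝ ∞ fun u => (s u).1.1 := (show IsPlot fun u => (s u).1.1 from hs.1).contDiff
    have key : ∀ u, z u = sphChart I (r u) → h u • z u = sphChart J (s u) → (r u).1.1 i ≠ 0 →
        ∃ hJ : i.1 ∈ J, (s u).1.1 ⟨i, hJ⟩ = (((h u).right : ℤ) : ℝ) * (r u).1.1 i ∧
          (s u).2 ⟨i, hJ⟩ = (h u).left * σ (h u).right ((r u).2 i) := by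
      intro u h1 h2 h3
      rw [h1, smul_sphChart] at h2
      have hq := Quotient.exact h2
      have e1 := DFunLike.congr_fun hq.1 i.1
      have e2 := hq.2 i.1
      simp only [extendZero_apply, Finset.coe_mem, dif_pos, PiLp.smul_apply, smul_eq_mul] at e1 e2
      have hne : (((h u).right : ℤ) : ℝ) * (r u).1.1 i ≠ 0 := mul_ne_zero (by simp) h3
      by_cases hJ : i.1 ∈ J
      · rw [dif_pos hJ] at e1
        have e3 := e2 hne
        rw [dif_pos hJ] at e3
        exact ⟨hJ, e1.symm, e3.symm⟩
      · rw [dif_neg hJ] at e1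
        exact absurd e1 hne
    obtain ⟨hJ, hx1, -⟩ := key x hzr.eq_of_nhds hzs.eq_of_nhds hi
    set ε := (h x).right
    have c1 : Continuous fun u => (r u).1.1 i := by
      have := hrc.continuous; fun_prop
    have c2 : Continuous fun u => (s u).1.1 ⟨i, hJ⟩ := by
      have := hsc.continuous; fun_prop
    have n1 : ∀ᶠ u in 𝓝 x, (r u).1.1 i ≠ 0 := c1.continuousAt.eventually_ne hi
    have n2 : ∀ᶠ u in 𝓝 x, 0 < (s u).1.1 ⟨i, hJ⟩ * (((ε : ℤ) : ℝ) * (r u).1.1 i) := by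
      refine (c2.mul (continuous_const.mul c1)).continuousAt.eventually (lt_mem_nhds ?_)
      simp only [Pi.mul_apply]
      rw [hx1]
      exact mul_self_pos.2 (mul_ne_zero (by simp) hi)
    refine ⟨fun u => ⟨(s u).2 ⟨i, hJ⟩ * (σ ε ((r u).2 i))⁻¹, ε⟩, ⟨?_, isPlot_const (x := ε)⟩, ?_⟩
    · exact IsPlot.mul' (hs.2 _) (IsPlot.inv' (hσ ε n _ (hr.2 i)))
    · filter_upwards [hzr, hzs, n1, n2] with u h1 h2 h3 h4
      obtain ⟨_, e1, e2⟩ := key u h1 h2 h3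
      have hε : (h u).right = ε := by
        rw [e1] at h4
        rcases Int.units_eq_one_or (h u).right with h5 | h5 <;>
          rcases Int.units_eq_one_or ε with h6 | h6 <;> rw [h5, h6] at h4 ⊢ <;> simp at h4 <;>
          nlinarith [mul_self_nonneg ((r u).1.1 i)]
      refine SemidirectProduct.ext ?_ hε
      simp [e2, hε]

end Milnor

/-! ### Čech cohomology of a diffeological space -/

/-- A Euclidean plot of `X`, that is, a plot defined on some `ℝⁿ`. -/
structure EuclideanPlot (X : Type u) [DiffeologicalSpace X] where
  dim : ℕ
  map : Euc dim → X
  isPlot : IsPlot map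

namespace EuclideanPlot

variable {X : Type*} [DiffeologicalSpace X] {Y : Type*} [DiffeologicalSpace Y]

/-- A morphism `p ⟶ q` is a smooth map `φ` between the domains with `q ∘ φ = p`. -/
@[ext]
structure Hom (p q : EuclideanPlot X) where
  toFun : Euc p.dim → Euc q.dim
  smooth : ContDiff ℝ ∞ toFun
  comm : ∀ x, q.map (toFun x) = p.map x

instance : Category (EuclideanPlot X) where
  Hom := Hom
  id p := ⟨id, contDiff_id, fun _ => rfl⟩
  comp φ ψ := ⟨ψ.toFun ∘ φ.toFun, ψ.smooth.comp φ.smooth,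
    fun x => (ψ.comm _).trans (φ.comm x)⟩

/-- Composition of Euclidean plots with a smooth map. -/
def push (f : X → Y) (hf : DSmooth f) : EuclideanPlot X ⥤ EuclideanPlot Y where
  obj p := ⟨p.dim, f ∘ p.map, hf _ _ p.isPlot⟩
  map φ := ⟨φ.toFun, φ.smooth, fun x => congrArg f (φ.comm x)⟩

end EuclideanPlot

/-! Cochains on the nerve of a category with coefficients in a presheaf of abelian groups, in low
degrees: an `n`-cochain assigns to a chain `x₀ ⟶ ⋯ ⟶ xₙ` an element of `F(x₀)`. -/

namespace Cochain

variable {C : Type*} [Category C] (F : Cᵒᵖ ⥤ AddCommGrpCat)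

abbrev C0 : Type _ := ∀ x : C, F.obj (op x)

abbrev C1 : Type _ := ∀ ⦃x y : C⦄ (_ : x ⟶ y), F.obj (op x)

abbrev C2 : Type _ := ∀ ⦃x y z : C⦄ (_ : x ⟶ y) (_ : y ⟶ z), F.obj (op x)

abbrev C3 : Type _ := ∀ ⦃x y z w : C⦄ (_ : x ⟶ y) (_ : y ⟶ z) (_ : z ⟶ w), F.obj (op x)

abbrev C4 : Type _ :=
  ∀ ⦃x y z w t : C⦄ (_ : x ⟶ y) (_ : y ⟶ z) (_ : z ⟶ w) (_ : w ⟶ t), F.obj (op x)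

def d0 : C0 F →+ C1 F where
  toFun c := fun x y φ => F.map φ.op (c y) - c x
  map_zero' := by ext; simp
  map_add' a b := by ext; simp; abel

def d1 : C1 F →+ C2 F where
  toFun c := fun _ _ _ φ ψ => F.map φ.op (c ψ) - c (φ ≫ ψ) + c φ
  map_zero' := by ext; simp
  map_add' a b := by ext; simp; abel

def d2 : C2 F →+ C3 F where
  toFun c := fun _ _ _ _ φ ψ χ =>
    F.map φ.op (c ψ χ) - c (φ ≫ ψ) χ + c φ (ψ ≫ χ) - c φ ψ
  map_zero' := by ext; simp
  map_add' a b := by ext; simp; abel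

def d3 : C3 F →+ C4 F where
  toFun c := fun _ _ _ _ _ φ ψ χ θ =>
    F.map φ.op (c ψ χ θ) - c (φ ≫ ψ) χ θ + c φ (ψ ≫ χ) θ - c φ ψ (χ ≫ θ) + c φ ψ χ
  map_zero' := by ext; simp
  map_add' a b := by ext; simp; abel

/-- `Hⁿ` is the group of `n`-cocycles modulo the `n`-coboundaries. -/
abbrev H1 : Type _ := (d1 F).ker ⧸ (d0 F).range.addSubgroupOf (d1 F).ker

abbrev H2 : Type _ := (d2 F).ker ⧸ (d1 F).range.addSubgroupOf (d2 F).ker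

abbrev H3 : Type _ := (d3 F).ker ⧸ (d2 F).range.addSubgroupOf (d3 F).ker

/-- A map of coefficients `F(T x) → F'(x)` over a functor `T`, natural in `x`. -/
structure CoeffMap {C D : Type*} [Category C] [Category D] (T : C ⥤ D)
    (F : Dᵒᵖ ⥤ AddCommGrpCat) (F' : Cᵒᵖ ⥤ AddCommGrpCat) where
  app : ∀ x : C, F.obj (op (T.obj x)) →+ F'.obj (op x)
  naturality : ∀ {x y : C} (φ : x ⟶ y) (m : F.obj (op (T.obj y))),
    app x (F.map (T.map φ).op m) = F'.map φ.op (app y m)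

namespace CoeffMap

variable {C D : Type*} [Category C] [Category D] {T : C ⥤ D}
  {F : Dᵒᵖ ⥤ AddCommGrpCat} {F' : Cᵒᵖ ⥤ AddCommGrpCat} (η : CoeffMap T F F')

def pull0 : C0 F →+ C0 F' where
  toFun c := fun x => η.app x (c (T.obj x))
  map_zero' := by ext; simp
  map_add' _ _ := by ext; simp

def pull1 : C1 F →+ C1 F' where
  toFun c := fun x _ φ => η.app x (c (T.map φ))
  map_zero' := by ext; simp
  map_add' _ _ := by ext; simp

def pull2 : C2 F →+ C2 F' where
  toFun c := fun x _ _ φ ψ => η.app x (c (T.map φ) (T.map ψ))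
  map_zero' := by ext; simp
  map_add' _ _ := by ext; simp

def pull3 : C3 F →+ C3 F' where
  toFun c := fun x _ _ _ φ ψ χ => η.app x (c (T.map φ) (T.map ψ) (T.map χ))
  map_zero' := by ext; simp
  map_add' _ _ := by ext; simp

def pull4 : C4 F →+ C4 F' where
  toFun c := fun x _ _ _ _ φ ψ χ θ => η.app x (c (T.map φ) (T.map ψ) (T.map χ) (T.map θ))
  map_zero' := by ext; simp
  map_add' _ _ := by ext; simp

lemma d0_pull (c : C0 F) : d0 F' (η.pull0 c) = η.pull1 (d0 F c) := by
  ext; simp [d0, pull0, pull1, η.naturality]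

lemma d1_pull (c : C1 F) : d1 F' (η.pull1 c) = η.pull2 (d1 F c) := by
  ext; simp [d1, pull1, pull2, η.naturality]

lemma d2_pull (c : C2 F) : d2 F' (η.pull2 c) = η.pull3 (d2 F c) := by
  ext; simp [d2, pull2, pull3, η.naturality]

lemma d3_pull (c : C3 F) : d3 F' (η.pull3 c) = η.pull4 (d3 F c) := by
  ext; simp [d3, pull3, pull4, η.naturality]

/-- The induced map on `H¹`. -/
def mapH1 : H1 F →+ H1 F' :=
  QuotientAddGroup.map _ _
    ((η.pull1.comp (d1 F).ker.subtype).codRestrict (d1 F').ker fun c => by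
      have hc : d1 F c.1 = 0 := c.2
      simp [AddMonoidHom.mem_ker, d1_pull, hc, map_zero η.pull2])
    (by
      rintro ⟨_, _⟩ ⟨b, rfl⟩
      exact ⟨η.pull0 b, η.d0_pull b⟩)

/-- The induced map on `H³`. -/
def mapH3 : H3 F →+ H3 F' :=
  QuotientAddGroup.map _ _
    ((η.pull3.comp (d3 F).ker.subtype).codRestrict (d3 F').ker fun c => by
      have hc : d3 F c.1 = 0 := c.2
      simp [AddMonoidHom.mem_ker, d3_pull, hc, map_zero η.pull4])
    (by
      rintro ⟨_, _⟩ ⟨b, rfl⟩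
      exact ⟨η.pull2 b, η.d2_pull b⟩)

end CoeffMap

end Cochain

open Cochain

/-- The constant coefficients `ℤ₂ = {±1}` (written additively). -/
def constZ2 (X : Type u) [DiffeologicalSpace X] : (EuclideanPlot X)ᵒᵖ ⥤ AddCommGrpCat.{0} :=
  (Functor.const _).obj (AddCommGrpCat.of (Additive ℤˣ))

section Twist

variable {G : Type*} [Group G] [DiffeologicalSpace G] {σ : ℤˣ →* MulAut G}
  {X : Type*} [DiffeologicalSpace X] {Y : Type*} [DiffeologicalSpace Y]

/-- Smooth sections over a Euclidean plot `p` of the bundle of groups associated with `P` and the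
action `(g, ε) ↦ χ(ε) = ±1` of `H_σ` on `M`: smooth equivariant `M`-valued functions on the
pull-back of `P` along `p`. -/
def equivariantFun (P : PrincipalBundle (HGroup σ) X) (χ : ℤˣ →* ℤˣ) (M : Type*) [AddCommGroup M]
    [DiffeologicalSpace M] [DiffeologicalAddGroup M] (p : EuclideanPlot X) :
    AddSubgroup (P.PullbackTotal p.map → M) where
  carrier := {m | DSmooth m ∧
    ∀ (h : HGroup σ) (z : P.PullbackTotal p.map), m (h • z) = ((χ h.right : ℤˣ) : ℤ) • m z}
  zero_mem' := ⟨dSmooth_const, fun _ _ => by simp⟩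
  add_mem' {a b} ha hb := ⟨fun n q hq => DiffeologicalAddGroup.smooth_add n
      (fun u => (a (q u), b (q u))) ⟨ha.1 n q hq, hb.1 n q hq⟩,
    fun h z => by simp [ha.2, hb.2, smul_add]⟩
  neg_mem' {a} ha := ⟨fun n q hq => DiffeologicalAddGroup.smooth_neg n _ (ha.1 n q hq),
    fun h z => by simp [ha.2]⟩

/-- The local system `M_α` of coefficients: the presheaf of smooth sections, over the Euclidean
plots of `X`, of the bundle with fibre `M` twisted by the `ℤ₂`-component of `P`. -/
def localSystem (P : PrincipalBundle (HGroup σ) X) (χ : ℤˣ →* ℤˣ) (M : Type*) [AddCommGroup M]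
    [DiffeologicalSpace M] [DiffeologicalAddGroup M] : (EuclideanPlot X)ᵒᵖ ⥤ AddCommGrpCat where
  obj p := AddCommGrpCat.of (equivariantFun P χ M p.unop)
  map {p q} φ := AddCommGrpCat.ofHom
    { toFun := fun m => ⟨fun z => m.1 ⟨(φ.unop.toFun z.1.1, z.1.2),
          z.2.trans (φ.unop.comm z.1.1).symm⟩,
        fun n r hr => m.2.1 n _
          (show _ ∧ _ from ⟨(φ.unop.smooth.comp hr.1.contDiff).isPlot, hr.2⟩),
        fun h z => m.2.2 h ⟨(φ.unop.toFun z.1.1, z.1.2), z.2.trans (φ.unop.comm z.1.1).symm⟩⟩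
      map_zero' := rfl
      map_add' := fun _ _ => rfl }

/-- The equivariant function underlying a section of a local system. -/
def sectionFun {P : PrincipalBundle (HGroup σ) X} {χ : ℤˣ →* ℤˣ} {M : Type*} [AddCommGroup M]
    [DiffeologicalSpace M] [DiffeologicalAddGroup M] {p : EuclideanPlot X}
    (m : (localSystem P χ M).obj (op p)) : P.PullbackTotal p.map → M :=
  Subtype.val (p := fun m => m ∈ equivariantFun P χ M p) m

/-- A bundle isomorphism `P ≅ f^*Q` induces the maps `f^* M_{α(Q)} → M_{α(P)}` of local systems. -/
def localSystemPull {P : PrincipalBundle (HGroup σ) X} {Q : PrincipalBundle (HGroup σ) Y}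
    (f : X → Y) (hf : DSmooth f) (Φ : P.Iso (Q.pullback f hf)) (χ : ℤˣ →* ℤˣ) (M : Type*)
    [AddCommGroup M] [DiffeologicalSpace M] [DiffeologicalAddGroup M] :
    CoeffMap (EuclideanPlot.push f hf) (localSystem Q χ M) (localSystem P χ M) where
  app p :=
    { toFun := fun (m : equivariantFun Q χ M _) => show equivariantFun P χ M p from
        ⟨fun z => m.1 ⟨(z.1.1, (Φ.toEquiv z.1.2).1.2),
          (Φ.toEquiv z.1.2).2.trans (congrArg f ((Φ.proj_comp z.1.2).trans z.2))⟩,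
        fun n r hr => m.2.1 n _
          (show _ ∧ _ from ⟨hr.1, (Φ.smooth_toFun n _ hr.2).2⟩),
        fun h z => by
          refine Eq.trans ?_ (m.2.2 h _)
          refine congrArg m.1 (Subtype.ext (Prod.ext rfl ?_))
          exact congrArg (fun t => t.1.2) (Φ.equivariant h z.1.2)⟩
      map_zero' := rfl
      map_add' := fun _ _ => rfl }
  naturality _ _ := rfl

/-- The pull-back `f^* : H¹(Y; ℤ₂) → H¹(X; ℤ₂)`. -/
def z2Pull (f : X → Y) (hf : DSmooth f) :
    CoeffMap (EuclideanPlot.push f hf) (constZ2 Y) (constZ2 X) where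
  app _ := AddMonoidHom.id (Additive ℤˣ)
  naturality _ _ := rfl

/-- A trivialization of `P` over all Euclidean plots: a smooth section `s_p` over each of them. -/
structure PlotSections (P : PrincipalBundle (HGroup σ) X) where
  sec : ∀ p : EuclideanPlot X, Euc p.dim → P.Total
  isPlot : ∀ p, IsPlot (sec p)
  proj_sec : ∀ p x, P.proj (sec p x) = p.map x

/-- The transition functions `h_φ = (g_φ, ε_φ)`, given by `s_p = h_φ • (s_q ∘ φ)` for `φ : p ⟶ q`.
They satisfy `h_{φ ≫ ψ} = h_φ * (h_ψ ∘ φ)`. -/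
def PlotSections.transition {P : PrincipalBundle (HGroup σ) X} (s : PlotSections P)
    {p q : EuclideanPlot X} (φ : p ⟶ q) (x : Euc p.dim) : HGroup σ :=
  P.div (y := s.sec p x) (z := s.sec q (φ.toFun x))
    ((s.proj_sec p x).trans ((φ.comm x).symm.trans (s.proj_sec q _).symm))

/-- `a` is the class `α(P)` of the cocycle `(ε_φ)` of `ℤ₂`-components of the transition functions,
for some trivialization of `P`. -/
def IsAlpha (P : PrincipalBundle (HGroup σ) X) (a : H1 (constZ2 X)) : Prop :=
  ∃ (s : PlotSections P) (c : (d1 (constZ2 X)).ker),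
    (∀ ⦃p q : EuclideanPlot X⦄ (φ : p ⟶ q) (x : Euc p.dim),
      (s.transition φ x).right = (show Additive ℤˣ from c.1 φ).toMul) ∧ a = QuotientAddGroup.mk c

/-- A central extension `1 → U(1) → Ĝ → G → 1` of diffeological groups (`incl` is an induction onto
the kernel of the subduction `quot`, with central image), together with a lift `act` to `Ĝ` of the
action `σ` of `ℤ₂` on `G`. -/
structure CircleExtension (σ : ℤˣ →* MulAut G) (Ghat : Type*) [Group Ghat]
    [DiffeologicalSpace Ghat] where
  incl : Circle →* Ghat
  quot : Ghat →* G
  act : ℤˣ →* MulAut Ghat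
  incl_injective : Function.Injective incl
  incl_induction : ∀ (n : ℕ) (z : Euc n → Circle), IsPlot z ↔ IsPlot (incl ∘ z)
  quot_subduction : IsSubduction quot
  range_incl : incl.range = quot.ker
  central : incl.range ≤ Subgroup.center Ghat
  act_smooth : ∀ ε, DSmooth (act ε)
  quot_act : ∀ ε g, quot (act ε g) = σ ε (quot g)

variable {Ghat : Type*} [Group Ghat] [DiffeologicalSpace Ghat]

open Classical in
/-- The character `χ` through which `ℤ₂` acts on the subgroup `U(1)` of `Ĝ`, as `z ↦ z ^ χ(ε)`:
trivial if the lifted action fixes `U(1)` pointwise, and `ε ↦ ε` otherwise (the only nontrivial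
smooth automorphism of `U(1)` being the inversion). -/
def CircleExtension.character (E : CircleExtension σ Ghat) : ℤˣ →* ℤˣ :=
  if ∀ ε z, E.act ε (E.incl z) = E.incl z then 1 else MonoidHom.id ℤˣ

/-- A trivialization of `P` over the Euclidean plots, with smooth lifts `ĝ_φ` to `Ĝ` of the
`G`-components `g_φ` of the transition functions. -/
structure LiftingData (E : CircleExtension σ Ghat) (P : PrincipalBundle (HGroup σ) X)
    extends PlotSections P where
  lift : ∀ ⦃p q : EuclideanPlot X⦄ (_ : p ⟶ q), Euc p.dim → Ghat
  isPlot_lift : ∀ ⦃p q : EuclideanPlot X⦄ (φ : p ⟶ q), IsPlot (lift φ)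
  quot_lift : ∀ ⦃p q : EuclideanPlot X⦄ (φ : p ⟶ q) (x : Euc p.dim),
    E.quot (lift φ x) = (toPlotSections.transition φ x).left

/-- The tautological point `(x, s_p(x))` of the pull-back of `P` along `p`. -/
def PlotSections.point {P : PrincipalBundle (HGroup σ) X} (s : PlotSections P)
    (p : EuclideanPlot X) (x : Euc p.dim) : P.PullbackTotal p.map :=
  ⟨(x, s.sec p x), s.proj_sec p x⟩

/-- The local system `U(1)_{α(P)}`. -/
abbrev circleSystem (E : CircleExtension σ Ghat) (P : PrincipalBundle (HGroup σ) X) :=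
  localSystem P E.character (Additive Circle)

/-- The local system `ℝ_{α(P)}`. -/
abbrev realSystem (E : CircleExtension σ Ghat) (P : PrincipalBundle (HGroup σ) X) :=
  localSystem P E.character ℝ

/-- The local system `ℤ_{α(P)}`. -/
abbrev intSystem (E : CircleExtension σ Ghat) (P : PrincipalBundle (HGroup σ) X) :=
  localSystem P E.character ℤ

/-- `b` is the obstruction class `β(P)` of the lifting gerbe: it is represented by a cocycle whose
coordinates in some trivialization are
`a_{φ,ψ} = ĝ_φ * σ̂^{ε_φ}(ĝ_ψ ∘ φ) * ĝ_{φ ≫ ψ}⁻¹`, for some smooth lifts `ĝ`. -/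
def IsBeta (E : CircleExtension σ Ghat) (P : PrincipalBundle (HGroup σ) X)
    (b : H2 (circleSystem E P)) : Prop :=
  ∃ (L : LiftingData E P) (a : (d2 (circleSystem E P)).ker),
    (∀ ⦃p q r : EuclideanPlot X⦄ (φ : p ⟶ q) (ψ : q ⟶ r) (x : Euc p.dim),
      E.incl (sectionFun (a.1 φ ψ) (L.point p x)).toMul =
        L.lift φ x * E.act (L.transition φ x).right (L.lift ψ (φ.toFun x)) *
          (L.lift (φ ≫ ψ) x)⁻¹) ∧
    b = QuotientAddGroup.mk a

/-- `d` is the image of `b` under the connecting morphism `H²(X; U(1)_α) → H³(X; ℤ_α)` of the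
twisted exponential sequence `0 → ℤ_α → ℝ_α → U(1)_α → 0`, `t ↦ exp (2π i t)`: for a cocycle `a`
representing `b` and a real cochain `r` with `exp (2π i r) = a`, the cocycle `n` representing `d` is
the coboundary of `r`. -/
def IsConnecting (E : CircleExtension σ Ghat) (P : PrincipalBundle (HGroup σ) X)
    (b : H2 (circleSystem E P)) (d : H3 (intSystem E P)) : Prop :=
  ∃ (a : (d2 (circleSystem E P)).ker) (r : C2 (realSystem E P)) (n : (d3 (intSystem E P)).ker),
    (∀ ⦃p q s : EuclideanPlot X⦄ (φ : p ⟶ q) (ψ : q ⟶ s) (z : P.PullbackTotal p.map),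
      Circle.exp (2 * Real.pi * sectionFun (r φ ψ) z) = (sectionFun (a.1 φ ψ) z).toMul) ∧
    (∀ ⦃p q s t : EuclideanPlot X⦄ (φ : p ⟶ q) (ψ : q ⟶ s) (χ : s ⟶ t)
      (z : P.PullbackTotal p.map),
      sectionFun (d2 (realSystem E P) r φ ψ χ) z = ((sectionFun (n.1 φ ψ χ) z : ℤ) : ℝ)) ∧
    b = QuotientAddGroup.mk a ∧ d = QuotientAddGroup.mk n

/-- The group in which twisting data live: `H¹(X; ℤ₂) × H³(X; ℤ_{α(P)})`. -/
abbrev TwistGroup (E : CircleExtension σ Ghat) (P : PrincipalBundle (HGroup σ) X) :=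
  H1 (constZ2 X) × H3 (intSystem E P)

/-- `t` is the pair `(α(P), DD_α(P))`, where `DD_α(P)` is the image of `β(P)` under the connecting
morphism. -/
def IsTwistingDatum (E : CircleExtension σ Ghat) (P : PrincipalBundle (HGroup σ) X)
    (t : TwistGroup E P) : Prop :=
  IsAlpha P t.1 ∧ ∃ b, IsBeta E P b ∧ IsConnecting E P b t.2

/-- The spherical twisting datum `τ(P) = (α(P), DD_α(P))`. -/
def twistingDatum (E : CircleExtension σ Ghat) (P : PrincipalBundle (HGroup σ) X) :
    TwistGroup E P :=
  Classical.epsilon (IsTwistingDatum E P)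

/-- The pull-back of twisting data along `f`, the local system of `P` being identified with the
pull-back of that of `Q` by the bundle isomorphism `Φ : P ≅ f^*Q`. -/
def twistPull (E : CircleExtension σ Ghat) {P : PrincipalBundle (HGroup σ) X}
    {Q : PrincipalBundle (HGroup σ) Y} (f : X → Y) (hf : DSmooth f)
    (Φ : P.Iso (Q.pullback f hf)) : TwistGroup E Q →+ TwistGroup E P :=
  (z2Pull f hf).mapH1.prodMap (localSystemPull f hf Φ E.character ℤ).mapH3

end Twist

end SphericalTwist

end

open SphericalTwist

/-!
Write `Ĥ = Ĝ ⋊ ℤ₂`. It is an extension of `H_σ` by `U(1)`, with `k z = z^{χ(ε)} k` for `k = (g, ε)`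
in `Ĥ`: a smooth involutive automorphism of `U(1)` is `z ↦ z` or `z ↦ z⁻¹`. In `Ĥ` the defining
equation of `a_{φ,ψ}` is `ĥ_φ (ĥ_ψ ∘ φ) = a_{φ,ψ} ĥ_{ψ ∘ φ}` with `ĥ_φ = (ĝ_φ, ε_φ)`. Associativity
makes `a` a cocycle for the coefficients twisted by `χ`, and comparing two choices through a lift to
`Ĥ` of the change of trivialization makes the two cocycles cohomologous.

Sections and lifts exist because a principal bundle has a smooth section over every Euclidean plot.
On two boxes with a common face, the sections differ near the face by a smooth `H`-valued map;
composing that map with a smooth retraction onto a neighbourhood of the face extends it to all of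
`ℝⁿ`, so that one section can be corrected to agree with the other. Bisection then gives sections on
all boxes, and `ℝⁿ` is exhausted by cubes. The extension `Ĥ → H_σ` is itself a principal
`U(1)`-bundle, which gives the lifts.

A smooth map `ℝⁿ → U(1)` is `exp (2π i r)` with `r` smooth, so that the exponential sequence is
exact on the local systems and the connecting morphism is well defined. Naturality holds on
cochains: sections and lifts for a bundle `Q` pull back through `Φ` to sections and lifts for
`P ≅ f^*Q` with the same transition functions.
-/

noncomputable section

namespace SphericalTwist

/-! ### Smooth retractions onto boxes -/

lemma exists_smooth_retract_closedBall {E : Type*} [NormedAddCommGroup E] [NormedSpace ℝ E]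
    [HasContDiffBump E] (x : E) {r R : ℝ} (hr : 0 ≤ r) (hrR : r < R) :
    ∃ f : E → E, ContDiff ℝ ∞ f ∧ (∀ y, f y ∈ Metric.ball x R) ∧
      ∀ y ∈ Metric.closedBall x r, f =ᶠ[𝓝 y] id := by
  let c : ContDiffBump x := ⟨(r + R) / 2, R, by linarith, by linarith⟩
  refine ⟨fun y => x + c y • (y - x),
    contDiff_const.add (c.contDiff.smul (contDiff_id.sub contDiff_const)), fun y => ?_,
    fun y hy => ?_⟩
  · rw [mem_ball_iff_norm, add_sub_cancel_left, norm_smul, Real.norm_eq_abs,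
      abs_of_nonneg c.nonneg]
    by_cases hy : dist y x < R
    · calc c y * ‖y - x‖ ≤ 1 * ‖y - x‖ := by gcongr; exact c.le_one
        _ < R := by rwa [one_mul, ← dist_eq_norm]
    · rw [c.zero_of_le_dist (not_lt.1 hy), zero_mul]
      linarith
  · have hmem : y ∈ Metric.ball x ((r + R) / 2) :=
      Metric.closedBall_subset_ball (by linarith) hy
    filter_upwards [c.eventuallyEq_one_of_mem_ball hmem] with z hz
    simp [hz]

/-- The closed box in `ℝⁿ` with lower corner `a` and upper corner `b`. -/
def box {n : ℕ} (a b : Fin n → ℝ) : Set (Euc n) := {x | x.ofLp ∈ Set.Icc a b}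

lemma box_subset_box {n : ℕ} {a b a' b' : Fin n → ℝ} (ha : a' ≤ a) (hb : b ≤ b') :
    box a b ⊆ box a' b' :=
  fun _ hx => Set.Icc_subset_Icc ha hb hx

lemma exists_smooth_retract_Icc {ι : Type*} [Fintype ι] {a b : ι → ℝ} (hab : a ≤ b)
    {U : Set (ι → ℝ)} (hU : IsOpen U) (h : Set.Icc a b ⊆ U) :
    ∃ f : (ι → ℝ) → ι → ℝ, ContDiff ℝ ∞ f ∧ (∀ y, f y ∈ U) ∧
      ∀ x ∈ Set.Icc a b, f =ᶠ[𝓝 x] id := by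
  obtain ⟨δ, hδ, hδU⟩ := isCompact_Icc.exists_thickening_subset_open hU h
  choose f hf hfball hfid using fun i => exists_smooth_retract_closedBall ((a i + b i) / 2)
    (r := (b i - a i) / 2) (R := δ + (b i - a i) / 2) (by linarith [hab i]) (by linarith)
  simp only [← Real.Icc_eq_closedBall] at hfid
  have hfnear : ∀ i t, ∃ z ∈ Set.Icc (a i) (b i), dist (f i t) z < δ := fun i t => by
    rw [← Metric.mem_thickening_iff, Real.Icc_eq_closedBall,
      thickening_closedBall hδ (by linarith [hab i])]
    exact hfball i t
  choose z hz hfz using hfnear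
  refine ⟨fun y i => f i (y i), by fun_prop, fun y => hδU (Metric.mem_thickening_iff.2
    ⟨fun i => z i (y i), ⟨fun i => (hz i _).1, fun i => (hz i _).2⟩,
      (dist_pi_lt_iff hδ).2 fun i => hfz i _⟩), fun x hx => ?_⟩
  have hi : ∀ i, ∀ᶠ y : ι → ℝ in 𝓝 x, f i (y i) = y i := fun i =>
    (continuous_apply i).continuousAt.eventually (hfid i _ ⟨hx.1 i, hx.2 i⟩)
  filter_upwards [Filter.eventually_all.2 hi] with y hy
  exact funext hy

lemma exists_smooth_retract_box {n : ℕ} {a b : Fin n → ℝ} (hab : a ≤ b) {U : Set (Euc n)}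
    (hU : IsOpen U) (h : box a b ⊆ U) :
    ∃ f : Euc n → Euc n, ContDiff ℝ ∞ f ∧ (∀ y, f y ∈ U) ∧ ∀ x ∈ box a b, f =ᶠ[𝓝 x] id := by
  obtain ⟨f, hf, hfU, hfid⟩ := exists_smooth_retract_Icc hab
    (hU.preimage (PiLp.continuous_toLp 2 _)) fun x hx => h (a := WithLp.toLp 2 x) hx
  refine ⟨fun y => WithLp.toLp 2 (f y.ofLp), by fun_prop, fun y => hfU _, fun x hx => ?_⟩
  filter_upwards [(PiLp.continuous_ofLp 2 _).continuousAt.eventually (hfid _ hx)] with y hy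
  simp [hy]

/-! ### Sections of principal bundles over Euclidean spaces -/

namespace PrincipalBundle

variable {H : Type*} [Group H] [DiffeologicalSpace H] {X : Type*} [DiffeologicalSpace X]
  (P : PrincipalBundle H X) {n : ℕ}

lemma eq_div_smul {y z : P.Total} (h : P.proj y = P.proj z) : y = P.div h • z :=
  (P.free_transitive y z h).choose_spec.1

lemma div_eq {y z : P.Total} (h : P.proj y = P.proj z) {k : H} (hk : y = k • z) : P.div h = k :=
  ((P.free_transitive y z h).choose_spec.2 k hk).symm

lemma smul_right_cancel {z : P.Total} {k l : H} (h : k • z = l • z) : k = l :=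
  (P.free_transitive (k • z) z (P.proj_smul k z)).unique rfl h

lemma isPlot_smul {h : Euc n → H} {z : Euc n → P.Total} (hh : IsPlot h) (hz : IsPlot z) :
    IsPlot fun x => h x • z x :=
  P.smooth_smul n (fun x => (h x, z x)) ⟨hh, hz⟩

lemma isPlot_div {y z : Euc n → P.Total} (hy : IsPlot y) (hz : IsPlot z)
    (h : ∀ x, P.proj (y x) = P.proj (z x)) : IsPlot fun x => P.div (h x) :=
  P.smooth_div n _ z hz (by simpa only [← P.eq_div_smul (h _)] using hy)

/-- Near `x`, the map `s` is a smooth section of `P` over `p`. -/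
def IsSectionAt (p : Euc n → X) (s : Euc n → P.Total) (x : Euc n) : Prop :=
  (∃ q : Euc n → P.Total, IsPlot q ∧ s =ᶠ[𝓝 x] q) ∧ ∀ᶠ y in 𝓝 x, P.proj (s y) = p y

/-- `P` has a smooth section over `p` on a neighbourhood of `K`. -/
def HasSectionNear (p : Euc n → X) (K : Set (Euc n)) : Prop :=
  ∃ s : Euc n → P.Total, ∀ x ∈ K, P.IsSectionAt p s x

variable {P} {p : Euc n → X} {s t : Euc n → P.Total} {x : Euc n} {a b : Fin n → ℝ}
  {K : Set (Euc n)}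

lemma IsSectionAt.congr (hs : P.IsSectionAt p s x) (h : t =ᶠ[𝓝 x] s) : P.IsSectionAt p t x := by
  obtain ⟨⟨q, hq, hsq⟩, hp⟩ := hs
  refine ⟨⟨q, hq, h.trans hsq⟩, ?_⟩
  filter_upwards [h, hp] with y hty hpy
  rw [hty, hpy]

lemma IsSectionAt.smul {h : Euc n → H} (hh : IsPlot h) (ht : P.IsSectionAt p t x) :
    P.IsSectionAt p (fun y => h y • t y) x := by
  obtain ⟨⟨q, hq, htq⟩, hp⟩ := ht
  exact ⟨⟨_, P.isPlot_smul hh hq, htq.mono fun y hy => congrArg (h y • ·) hy⟩,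
    hp.mono fun y hy => (P.proj_smul _ _).trans hy⟩

lemma isOpen_isSectionAt (p : Euc n → X) (s : Euc n → P.Total) :
    IsOpen {x | P.IsSectionAt p s x} := by
  refine isOpen_iff_mem_nhds.2 ?_
  rintro x ⟨⟨q, hq, hsq⟩, hp⟩
  filter_upwards [eventually_eventually_nhds.2 hsq, eventually_eventually_nhds.2 hp] with y h₁ h₂
  exact ⟨⟨q, hq, h₁⟩, h₂⟩

lemma isPlot_comp_of_isSectionAt {r : Euc n → Euc n} (hr : ContDiff ℝ ∞ r)
    (h : ∀ y, P.IsSectionAt p s (r y)) : IsPlot (s ∘ r) :=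
  isPlot_of_nhds fun x =>
    let ⟨⟨q, hq, hsq⟩, _⟩ := h x
    ⟨q ∘ r, isPlot_reparam hq hr, hr.continuous.continuousAt.eventually hsq⟩

lemma exists_eventuallyEq_smul_near_box (hab : a ≤ b) (hs : ∀ x ∈ box a b, P.IsSectionAt p s x)
    (ht : ∀ x ∈ box a b, P.IsSectionAt p t x) :
    ∃ h : Euc n → H, IsPlot h ∧ ∀ x ∈ box a b, s =ᶠ[𝓝 x] fun y => h y • t y := by
  obtain ⟨r, hr, hrU, hrid⟩ := exists_smooth_retract_box hab
    ((isOpen_isSectionAt p s).inter (isOpen_isSectionAt p t)) fun x hx => ⟨hs x hx, ht x hx⟩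
  have hproj : ∀ y, P.proj ((s ∘ r) y) = P.proj ((t ∘ r) y) := fun y =>
    (hrU y).1.2.self_of_nhds.trans (hrU y).2.2.self_of_nhds.symm
  refine ⟨fun y => P.div (hproj y), P.isPlot_div (isPlot_comp_of_isSectionAt hr fun y => (hrU y).1)
    (isPlot_comp_of_isSectionAt hr fun y => (hrU y).2) hproj, fun x hx => ?_⟩
  filter_upwards [hrid x hx] with y hy
  simpa only [Function.comp_apply, hy, id] using P.eq_div_smul (hproj y)

lemma HasSectionNear.exists_extension (hK : P.HasSectionNear p K) (hab : a ≤ b)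
    (hs : ∀ x ∈ box a b, P.IsSectionAt p s x) (hsub : box a b ⊆ K) :
    ∃ t : Euc n → P.Total, (∀ x ∈ K, P.IsSectionAt p t x) ∧ ∀ x ∈ box a b, t =ᶠ[𝓝 x] s := by
  obtain ⟨t, ht⟩ := hK
  obtain ⟨h, hh, hst⟩ := exists_eventuallyEq_smul_near_box hab hs fun x hx => ht x (hsub hx)
  exact ⟨fun y => h y • t y, fun x hx => (ht x hx).smul hh, fun x hx => (hst x hx).symm⟩

lemma HasSectionNear.glue {i : Fin n} {c : ℝ} (hab : a ≤ b) (hac : a i ≤ c) (hcb : c ≤ b i)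
    (hlow : P.HasSectionNear p (box a (Function.update b i c)))
    (hupp : P.HasSectionNear p (box (Function.update a i c) b)) :
    P.HasSectionNear p (box a b) := by
  have ha : a ≤ Function.update a i c := le_update_iff.2 ⟨hac, fun _ _ => le_rfl⟩
  have hb : Function.update b i c ≤ b := update_le_iff.2 ⟨hcb, fun _ _ => le_rfl⟩
  have hwall : Function.update a i c ≤ Function.update b i c :=
    update_le_update_iff.2 ⟨le_rfl, fun j _ => hab j⟩
  have hcont : Continuous fun y : Euc n => y i := by fun_prop
  obtain ⟨s, hs⟩ := hlow
  obtain ⟨t, ht, hts⟩ := hupp.exists_extension hwall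
    (fun x hx => hs x (box_subset_box ha le_rfl hx)) (box_subset_box le_rfl hb)
  refine ⟨fun y => if y i ≤ c then s y else t y, fun x hx => ?_⟩
  rcases lt_trichotomy (x i) c with hlt | heq | hgt
  · refine (hs x ⟨hx.1, le_update_iff.2 ⟨hlt.le, fun j _ => hx.2 j⟩⟩).congr ?_
    filter_upwards [hcont.continuousAt.eventually (gt_mem_nhds hlt)] with y hy
    exact if_pos hy.le
  · have hxwall : x ∈ box (Function.update a i c) (Function.update b i c) :=
      ⟨update_le_iff.2 ⟨heq.ge, fun j _ => hx.1 j⟩, le_update_iff.2 ⟨heq.le, fun j _ => hx.2 j⟩⟩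
    refine (hs x (box_subset_box ha le_rfl hxwall)).congr ?_
    filter_upwards [hts x hxwall] with y hy
    rw [hy, ite_self]
  · refine (ht x ⟨update_le_iff.2 ⟨hgt.le, fun j _ => hx.1 j⟩, hx.2⟩).congr ?_
    filter_upwards [hcont.continuousAt.eventually (lt_mem_nhds hgt)] with y hy
    exact if_neg (not_le.2 hy)

lemma HasSectionNear.of_splitCenterBox (I : BoxIntegral.Box (Fin n))
    (h : ∀ T : Set (Fin n),
      P.HasSectionNear p (box (I.splitCenterBox T).lower (I.splitCenterBox T).upper)) :
    P.HasSectionNear p (box I.lower I.upper) := by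
  classical
  suffices hS : ∀ (S : Finset (Fin n)) (T : Set (Fin n)), P.HasSectionNear p
      (box (S.piecewise I.lower (I.splitCenterBox T).lower)
        (S.piecewise I.upper (I.splitCenterBox T).upper)) by
    simpa only [Finset.piecewise_univ] using hS Finset.univ Set.univ
  -- The cuts in the directions `i ∈ S` have been glued, those in the other directions have not.
  intro S
  induction S using Finset.induction_on with
  | empty => simpa only [Finset.piecewise_empty] using h
  | insert i S hi ih =>
    intro T
    have hle := I.lower_le_upper
    refine HasSectionNear.glue (i := i) (c := (I.lower i + I.upper i) / 2) ?_ ?_ ?_ ?_ ?_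
    · exact Finset.piecewise_le_piecewise _ hle (I.splitCenterBox T).lower_le_upper
    · rw [Finset.piecewise_insert_self]; linarith [hle i]
    · rw [Finset.piecewise_insert_self]; linarith [hle i]
    · convert ih (T \ {i}) using 2 <;> ext j <;>
        simp only [BoxIntegral.Box.splitCenterBox, Set.piecewise, Finset.piecewise, Function.update,
          Finset.mem_insert, Set.mem_sdiff, Set.mem_singleton_iff] <;>
        grind
    · convert ih (insert i T) using 2 <;> ext j <;>
        simp only [BoxIntegral.Box.splitCenterBox, Set.piecewise, Finset.piecewise, Function.update,
          Finset.mem_insert, Set.mem_insert_iff] <;>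
        grind

variable (P) in
lemma hasSectionNear_box (hp : IsPlot p) (hab : ∀ i, a i < b i) :
    P.HasSectionNear p (box a b) := by
  refine BoxIntegral.Box.subbox_induction_on' (p := fun J => P.HasSectionNear p
    (box J.lower J.upper)) ⟨a, b, hab⟩ (fun J _ => HasSectionNear.of_splitCenterBox J) fun z _ => ?_
  obtain ⟨q, hq, hpq⟩ := P.subduction.lifts n p hp (WithLp.toLp 2 z)
  have hz : P.IsSectionAt p q (WithLp.toLp 2 z) :=
    ⟨⟨q, hq, Filter.EventuallyEq.rfl⟩, hpq.mono fun _ hy => hy.symm⟩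
  have hopen := (isOpen_isSectionAt p q).preimage (PiLp.continuous_toLp 2 _)
  exact ⟨_, mem_nhdsWithin_of_mem_nhds (hopen.mem_nhds hz), fun J _ _ _ hJ _ =>
    ⟨q, fun _ hx => hJ hx⟩⟩

end PrincipalBundle

/-- The cubes `[-(k + 1), k + 1]ⁿ`, which exhaust `ℝⁿ`; the shift makes them nondegenerate. -/
def cube (n k : ℕ) : Set (Euc n) := box (fun _ => -(k + 1)) fun _ => k + 1

lemma cube_mono (n : ℕ) : Monotone (cube n) := fun k l h => by
  have hkl : (k : ℝ) ≤ l := by exact_mod_cast h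
  exact box_subset_box (fun _ => by linarith) fun _ => by linarith

lemma mem_cube_of_norm_le {n k : ℕ} {x : Euc n} (h : ‖x‖ ≤ k) : x ∈ cube n k := by
  have hx : ∀ i, |x i| ≤ k + 1 := fun i =>
    ((PiLp.norm_apply_le x i).trans h).trans (by linarith)
  exact ⟨fun i => (abs_le.1 (hx i)).1, fun i => (abs_le.1 (hx i)).2⟩

namespace PrincipalBundle

variable {H : Type*} [Group H] [DiffeologicalSpace H] {X : Type*} [DiffeologicalSpace X]
  (P : PrincipalBundle H X) {n : ℕ} {p : Euc n → X}

lemma exists_sections_near_cubes (hp : IsPlot p) :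
    ∃ S : ℕ → Euc n → P.Total, (∀ k, ∀ x ∈ cube n k, P.IsSectionAt p (S k) x) ∧
      ∀ k, ∀ x ∈ cube n k, S (k + 1) x = S k x := by
  have hlt : ∀ k : ℕ, -((k : ℝ) + 1) < k + 1 := fun k => by linarith [k.cast_nonneg (α := ℝ)]
  have hcube : ∀ k, P.HasSectionNear p (cube n k) := fun k =>
    P.hasSectionNear_box hp fun _ => hlt k
  have hextend : ∀ k (s : {s : Euc n → P.Total // ∀ x ∈ cube n k, P.IsSectionAt p s x}),
      ∃ t : {t : Euc n → P.Total // ∀ x ∈ cube n (k + 1), P.IsSectionAt p t x},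
        ∀ x ∈ cube n k, t.1 x = s.1 x := fun k s =>
    let ⟨t, ht, hts⟩ := (hcube (k + 1)).exists_extension (fun _ => (hlt k).le) s.2
      (cube_mono n k.le_succ)
    ⟨⟨t, ht⟩, fun x hx => (hts x hx).self_of_nhds⟩
  choose next hnext using hextend
  let S : ∀ k, {s : Euc n → P.Total // ∀ x ∈ cube n k, P.IsSectionAt p s x} :=
    fun k => Nat.rec ⟨(hcube 0).choose, (hcube 0).choose_spec⟩ next k
  exact ⟨fun k => (S k).1, fun k => (S k).2, fun k => hnext k (S k)⟩

theorem exists_section (hp : IsPlot p) :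
    ∃ s : Euc n → P.Total, IsPlot s ∧ ∀ x, P.proj (s x) = p x := by
  obtain ⟨S, hS, hsucc⟩ := P.exists_sections_near_cubes hp
  have heq : ∀ k l, k ≤ l → ∀ x ∈ cube n k, S l x = S k x := fun k l h => by
    induction l, h using Nat.le_induction with
    | base => exact fun _ _ => rfl
    | succ l hkl ih => exact fun x hx => (hsucc l x (cube_mono n hkl hx)).trans (ih x hx)
  have hs : ∀ x, P.IsSectionAt p (fun y => S ⌈‖y‖⌉₊ y) x := fun x => by
    obtain ⟨k, hk⟩ := exists_nat_gt ‖x‖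
    refine (hS k x (mem_cube_of_norm_le hk.le)).congr ?_
    filter_upwards [continuous_norm.continuousAt.eventually (gt_mem_nhds hk)] with y hy
    exact (heq _ _ (Nat.ceil_le.2 hy.le) y (mem_cube_of_norm_le (Nat.le_ceil _))).symm
  exact ⟨_, isPlot_of_nhds fun x => (hs x).1, fun x => (hs x).2.self_of_nhds⟩

end PrincipalBundle

/-! ### Circle-valued functions and endomorphisms of the circle -/

lemma isLocallyConstant_of_continuous_intCast {T : Type*} [TopologicalSpace T] {k : T → ℤ}
    (h : Continuous fun t => (k t : ℝ)) : IsLocallyConstant k :=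
  (IsLocallyConstant.iff_continuous k).2
    (Int.isClosedEmbedding_coe_real.isEmbedding.continuous_iff.2 h)

lemma exp_two_pi_eq_one_iff {t : ℝ} : Circle.exp (2 * Real.pi * t) = 1 ↔ ∃ k : ℤ, t = k := by
  rw [Circle.exp_eq_one]
  exact exists_congr fun k => by rw [mul_comm (k : ℝ), mul_right_inj' Real.two_pi_pos.ne']

lemma isPlot_circle_exp {n : ℕ} {r : Euc n → ℝ} (hr : ContDiff ℝ ∞ r) :
    IsPlot fun x => Circle.exp (r x) := by
  simp only [isPlot_circle_iff, Circle.coe_exp]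
  exact (Complex.contDiff_exp (𝕜 := ℝ)).comp
    ((Complex.ofRealCLM.contDiff.comp hr).mul contDiff_const)

lemma existsUnique_continuous_circle_lift {A : Type*} [TopologicalSpace A] [SimplyConnectedSpace A]
    [LocallyPathConnectedSpace A] {f : A → Circle} (hf : Continuous f) (a : A) {t : ℝ}
    (ht : Circle.exp t = f a) :
    ∃! r : C(A, ℝ), r a = t ∧ ∀ x, Circle.exp (r x) = f x := by
  simpa only [funext_iff, Function.comp_apply, ContinuousMap.coe_mk] using
    Circle.isCoveringMap_exp.existsUnique_continuousMap_lifts ⟨f, hf⟩ a t ht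

lemma contDiff_of_isPlot_circle_exp {n : ℕ} {r : Euc n → ℝ} (hr : Continuous r)
    (h : IsPlot fun x => Circle.exp (r x)) : ContDiff ℝ ∞ r := by
  refine contDiff_iff_contDiffAt.2 fun x => ?_
  let w : Euc n → ℂ := fun y => Circle.exp (r y) / Circle.exp (r x)
  have hw : ContDiff ℝ ∞ w := (isPlot_circle_iff.1 h).div_const _
  have hwx : w x ∈ Complex.slitPlane := by simp [w]
  have hlog : ContDiffAt ℝ ∞ (fun y => Complex.log (w y)) x :=
    ((Complex.contDiffAt_log hwx).restrict_scalars ℝ).comp x hw.contDiffAt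
  refine ((Complex.imCLM.contDiff.contDiffAt.comp x hlog).add
    (contDiffAt_const (c := r x))).congr_of_eventuallyEq ?_
  have hnear : ∀ᶠ y in 𝓝 x, |r y - r x| < Real.pi := by
    simpa only [← Real.dist_eq] using Metric.tendsto_nhds.1 (hr.tendsto x) _ Real.pi_pos
  filter_upwards [hnear] with y hy
  obtain ⟨hl, hu⟩ := abs_lt.1 hy
  have harg : Complex.arg (w y) = r y - r x := by
    rw [← Circle.arg_exp hl hu.le, Circle.exp_sub, Circle.coe_div]
  change r y = (Complex.log (w y)).im + r x
  rw [Complex.log_im, harg, sub_add_cancel]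

lemma exists_contDiff_circle_lift {n : ℕ} {p : Euc n → Circle} (hp : IsPlot p) :
    ∃ r : Euc n → ℝ, ContDiff ℝ ∞ r ∧ ∀ x, Circle.exp (2 * Real.pi * r x) = p x := by
  have hpc : Continuous p := continuous_induced_rng.2 (isPlot_circle_iff.1 hp).continuous
  obtain ⟨r, ⟨-, hr⟩, -⟩ := existsUnique_continuous_circle_lift hpc 0 (Circle.exp_arg (p 0))
  have hsmooth : ContDiff ℝ ∞ r :=
    contDiff_of_isPlot_circle_exp r.continuous (by simpa only [hr] using hp)
  refine ⟨fun x => r x / (2 * Real.pi), hsmooth.div_const _, fun x => ?_⟩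
  rw [mul_div_cancel₀ _ Real.two_pi_pos.ne', hr]

lemma exists_eq_zpow_of_continuous {θ : Circle →* Circle} (hθ : Continuous θ) :
    ∃ m : ℤ, ∀ z, θ z = z ^ m := by
  obtain ⟨ρ, ⟨hρ₀, hρ⟩, -⟩ := existsUnique_continuous_circle_lift
    (hθ.comp (ContinuousMap.continuous Circle.exp)) (0 : ℝ) (t := 0) (by simp)
  simp only [Function.comp_apply] at hρ
  have hadd : ∀ s t, ρ (s + t) = ρ s + ρ t := fun s t => by
    have hshift : (⟨fun t => ρ (s + t) - ρ s, by fun_prop⟩ : C(ℝ, ℝ)) = ρ :=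
      (existsUnique_continuous_circle_lift
        (hθ.comp (ContinuousMap.continuous Circle.exp)) (0 : ℝ) (t := 0) (by simp)).unique
        ⟨by simp, fun t => by simp [Circle.exp_sub, Circle.exp_add, hρ]⟩ ⟨hρ₀, hρ⟩
    linarith [show ρ (s + t) - ρ s = ρ t from DFunLike.congr_fun hshift t]
  have hlin : ∀ t, ρ t = t * ρ 1 := fun t => by
    simpa using map_real_smul (AddMonoidHom.mk' ρ hadd) ρ.continuous t 1
  obtain ⟨m, hm⟩ : ∃ m : ℤ, ρ 1 = m := exp_two_pi_eq_one_iff.1 (by rw [← hlin, hρ]; simp)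
  refine ⟨m, fun z => ?_⟩
  rw [← Circle.exp_arg z, ← hρ, hlin, hm, mul_comm, ← zsmul_eq_mul, Circle.exp_zsmul]

lemma continuous_of_dSmooth_circle {θ : Circle → Circle} (hθ : DSmooth θ) : Continuous θ := by
  have hexp : Topology.IsQuotientMap (Circle.exp : ℝ → Circle) :=
    isLocalHomeomorph_circleExp.isOpenMap.isQuotientMap (ContinuousMap.continuous _)
      Circle.exp_surjective
  rw [hexp.continuous_iff]
  have hplot := hθ 1 _ (isPlot_circle_exp (contDiff_euclidean.1 contDiff_id 0))
  exact (continuous_induced_rng.2 (isPlot_circle_iff.1 hplot).continuous).comp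
    ((PiLp.continuous_toLp 2 fun _ : Fin 1 => ℝ).comp (continuous_pi fun _ => continuous_id))

lemma eq_zero_of_forall_circle_zpow_eq_one {k : ℤ} (h : ∀ z : Circle, z ^ k = 1) : k = 0 := by
  by_contra hk
  have hk' : (k : ℝ) ≠ 0 := Int.cast_ne_zero.2 hk
  obtain ⟨m, hm⟩ : ∃ m : ℤ, (1 / 2 : ℝ) = m := by
    rw [← exp_two_pi_eq_one_iff, ← h (Circle.exp (Real.pi / k)), ← Circle.exp_zsmul, zsmul_eq_mul,
      mul_div_cancel₀ _ hk']
    ring_nf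
  have : (1 : ℤ) = 2 * m := by exact_mod_cast (by linarith : (1 : ℝ) = 2 * m)
  omega

lemma eq_id_or_eq_inv_of_involutive {θ : Circle →* Circle} (hθ : Continuous θ)
    (hinv : Function.Involutive θ) : (∀ z, θ z = z) ∨ ∀ z, θ z = z⁻¹ := by
  obtain ⟨m, hm⟩ := exists_eq_zpow_of_continuous hθ
  have hmm : m * m = 1 := sub_eq_zero.1 <| eq_zero_of_forall_circle_zpow_eq_one fun z => by
    rw [zpow_sub, zpow_mul, ← hm, ← hm, hinv, zpow_one, mul_inv_cancel]
  refine (mul_self_eq_one_iff.1 hmm).imp (fun h z => ?_) fun h z => ?_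
  · rw [hm, h, zpow_one]
  · rw [hm, h, zpow_neg_one]

/-! ### Short exact sequences of coefficients -/

namespace Cochain

section Cohomology

variable {C : Type*} [Category C] (F : Cᵒᵖ ⥤ AddCommGrpCat)

lemma d2_d1 (c : C1 F) : d2 F (d1 F c) = 0 := by
  ext
  simp only [d1, d2, AddMonoidHom.coe_mk, ZeroHom.coe_mk, map_add, map_sub, op_comp, F.map_comp,
    AddCommGrpCat.comp_apply, Category.assoc, Pi.zero_apply]
  abel

lemma d3_d2 (c : C2 F) : d3 F (d2 F c) = 0 := by
  ext
  simp only [d2, d3, AddMonoidHom.coe_mk, ZeroHom.coe_mk, map_add, map_sub, op_comp, F.map_comp,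
    AddCommGrpCat.comp_apply, Category.assoc, Pi.zero_apply]
  abel

variable {F}

lemma mk_eq_mk_H1 {c c' : (d1 F).ker} :
    (QuotientAddGroup.mk c : H1 F) = QuotientAddGroup.mk c' ↔ ∃ e, d0 F e = -c.1 + c'.1 :=
  QuotientAddGroup.eq

lemma mk_eq_mk_H2 {c c' : (d2 F).ker} :
    (QuotientAddGroup.mk c : H2 F) = QuotientAddGroup.mk c' ↔ ∃ e, d1 F e = -c.1 + c'.1 :=
  QuotientAddGroup.eq

lemma mk_eq_mk_H3 {c c' : (d3 F).ker} :
    (QuotientAddGroup.mk c : H3 F) = QuotientAddGroup.mk c' ↔ ∃ e, d2 F e = -c.1 + c'.1 :=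
  QuotientAddGroup.eq

end Cohomology

/-- The induced map on `H²`. -/
def CoeffMap.mapH2 {C D : Type*} [Category C] [Category D] {T : C ⥤ D}
    {F : Dᵒᵖ ⥤ AddCommGrpCat} {F' : Cᵒᵖ ⥤ AddCommGrpCat} (η : CoeffMap T F F') : H2 F →+ H2 F' :=
  QuotientAddGroup.map _ _
    ((η.pull2.comp (d2 F).ker.subtype).codRestrict (d2 F').ker fun c => by
      have hc : d2 F c.1 = 0 := c.2
      simp [AddMonoidHom.mem_ker, d2_pull, hc, map_zero η.pull3])
    (by
      rintro ⟨_, _⟩ ⟨b, rfl⟩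
      exact ⟨η.pull1 b, η.d1_pull b⟩)

variable {C : Type*} [Category C] {F₁ F₂ F₃ : Cᵒᵖ ⥤ AddCommGrpCat}
  {ι : CoeffMap (𝟭 C) F₁ F₂} {π : CoeffMap (𝟭 C) F₂ F₃}

/-- The sequence `0 → F₁ → F₂ → F₃ → 0` of presheaves, given by `ι` and `π`, is exact. -/
structure IsShortExact (ι : CoeffMap (𝟭 C) F₁ F₂) (π : CoeffMap (𝟭 C) F₂ F₃) : Prop where
  injective : ∀ x, Function.Injective (ι.app x)
  exact : ∀ x, Function.Exact (ι.app x) (π.app x)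
  surjective : ∀ x, Function.Surjective (π.app x)

/-- `d` is the image of `b` under the connecting morphism `H²(F₃) → H³(F₁)` of the short exact
sequence `0 → F₁ → F₂ → F₃ → 0`: a relation, which `IsShortExact` makes functional. -/
def IsConnectingClass (ι : CoeffMap (𝟭 C) F₁ F₂) (π : CoeffMap (𝟭 C) F₂ F₃) (b : H2 F₃)
    (d : H3 F₁) : Prop :=
  ∃ (a : (d2 F₃).ker) (r : C2 F₂) (n : (d3 F₁).ker), π.pull2 r = a.1 ∧ d2 F₂ r = ι.pull3 n.1 ∧
    b = QuotientAddGroup.mk a ∧ d = QuotientAddGroup.mk n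

namespace IsShortExact

variable (h : IsShortExact ι π)

include h

lemma pull1_surjective : Function.Surjective π.pull1 := fun c =>
  ⟨fun x _ φ => Function.surjInv (h.surjective x) (c φ), by
    funext x y φ; exact Function.surjInv_eq (h.surjective x) _⟩

lemma pull2_surjective : Function.Surjective π.pull2 := fun c =>
  ⟨fun x _ _ φ ψ => Function.surjInv (h.surjective x) (c φ ψ), by
    funext x y z φ ψ; exact Function.surjInv_eq (h.surjective x) _⟩

lemma pull3_injective : Function.Injective ι.pull3 := fun c c' hc => by
  simp only [funext_iff] at hc
  funext x y z w φ ψ χ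
  exact h.injective x (hc x y z w φ ψ χ)

lemma pull4_injective : Function.Injective ι.pull4 := fun c c' hc => by
  simp only [funext_iff] at hc
  funext x y z w t φ ψ χ θ
  exact h.injective x (hc x y z w t φ ψ χ θ)

lemma exists_pull2_eq {c : C2 F₂} (hc : π.pull2 c = 0) : ∃ e, ι.pull2 e = c := by
  simp only [funext_iff] at hc
  choose e he using fun x y z φ ψ => (h.exact x _).1 (hc x y z φ ψ)
  exact ⟨fun x y z => e x y z, by funext x y z φ ψ; exact he x y z φ ψ⟩

lemma exists_pull3_eq {c : C3 F₂} (hc : π.pull3 c = 0) : ∃ e, ι.pull3 e = c := by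
  simp only [funext_iff] at hc
  choose e he using fun x y z w φ ψ χ => (h.exact x _).1 (hc x y z w φ ψ χ)
  exact ⟨fun x y z w => e x y z w, by funext x y z w φ ψ χ; exact he x y z w φ ψ χ⟩

lemma exists_isConnectingClass (b : H2 F₃) : ∃ d, IsConnectingClass ι π b d := by
  induction b using QuotientAddGroup.induction_on with
  | H a =>
  obtain ⟨r, hr⟩ := h.pull2_surjective a.1
  have ha : d2 F₃ a.1 = 0 := a.2
  obtain ⟨n, hn⟩ := h.exists_pull3_eq (c := d2 F₂ r) (by rw [← π.d2_pull, hr, ha])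
  have hdn : d3 F₁ n = 0 :=
    h.pull4_injective (by rw [← ι.d3_pull, hn, d3_d2, map_zero])
  exact ⟨_, a, r, ⟨n, hdn⟩, hr, hn.symm, rfl, rfl⟩

lemma isConnectingClass_unique {b : H2 F₃} {d d' : H3 F₁} (hd : IsConnectingClass ι π b d)
    (hd' : IsConnectingClass ι π b d') : d = d' := by
  obtain ⟨a, r, n, hr, hn, rfl, rfl⟩ := hd
  obtain ⟨a', r', n', hr', hn', hb, rfl⟩ := hd'
  obtain ⟨e, he⟩ := mk_eq_mk_H2.1 hb
  obtain ⟨t, ht⟩ := h.pull1_surjective e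
  obtain ⟨m, hm⟩ := h.exists_pull2_eq (c := -r + r' - d1 F₂ t) (by
    rw [map_sub, map_add, map_neg, ← π.d1_pull, ht, hr, hr', he, sub_self])
  refine mk_eq_mk_H3.2 ⟨m, h.pull3_injective ?_⟩
  rw [← ι.d2_pull, hm, map_sub, map_add, map_neg, d2_d1, sub_zero, hn, hn', map_add, map_neg]

end IsShortExact

end Cochain

open Cochain

/-! ### Sections of the local systems -/

variable {G : Type*} [Group G] [DiffeologicalSpace G] {σ : ℤˣ →* MulAut G}
  {X : Type*} [DiffeologicalSpace X] {Y : Type*} [DiffeologicalSpace Y]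

lemma isLocallyConstant_right {n : ℕ} {h : Euc n → HGroup σ} (hh : IsPlot h) :
    IsLocallyConstant fun x => (h x).right :=
  hh.2

lemma right_eq_right_of_isPlot {n : ℕ} {h : Euc n → HGroup σ} (hh : IsPlot h) (x y : Euc n) :
    (h x).right = (h y).right :=
  (isLocallyConstant_right hh).apply_eq_of_preconnectedSpace x y

lemma isPlot_left {n : ℕ} {h : Euc n → HGroup σ} (hh : IsPlot h) : IsPlot fun x => (h x).left :=
  hh.1

section Sections

variable {P : PrincipalBundle (HGroup σ) X} {χ : ℤˣ →* ℤˣ} {M : Type*} [AddCommGroup M]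
  [DiffeologicalSpace M] [DiffeologicalAddGroup M] {p q : EuclideanPlot X}

lemma dSmooth_sectionFun (m : (localSystem P χ M).obj (op p)) : DSmooth (sectionFun m) :=
  m.2.1

lemma sectionFun_smul (m : (localSystem P χ M).obj (op p)) (h : HGroup σ)
    (z : P.PullbackTotal p.map) :
    sectionFun m (h • z) = ((χ h.right : ℤˣ) : ℤ) • sectionFun m z :=
  m.2.2 h z

lemma sectionFun_ext {m m' : (localSystem P χ M).obj (op p)}
    (h : ∀ z, sectionFun m z = sectionFun m' z) : m = m' :=
  Subtype.ext (funext h)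

lemma sectionFun_add (m m' : (localSystem P χ M).obj (op p)) (z : P.PullbackTotal p.map) :
    sectionFun (m + m') z = sectionFun m z + sectionFun m' z := rfl

lemma sectionFun_neg (m : (localSystem P χ M).obj (op p)) (z : P.PullbackTotal p.map) :
    sectionFun (-m) z = -sectionFun m z := rfl

lemma sectionFun_sub (m m' : (localSystem P χ M).obj (op p)) (z : P.PullbackTotal p.map) :
    sectionFun (m - m') z = sectionFun m z - sectionFun m' z := by
  rw [sub_eq_add_neg, sectionFun_add, sectionFun_neg, ← sub_eq_add_neg]

lemma sectionFun_zero (z : P.PullbackTotal p.map) :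
    sectionFun (0 : (localSystem P χ M).obj (op p)) z = 0 := rfl

lemma isPlot_units_smul {n : ℕ} {ε : Euc n → ℤˣ} (hε : IsLocallyConstant ε) {f : Euc n → M}
    (hf : IsPlot f) : IsPlot fun x => ((ε x : ℤˣ) : ℤ) • f x := by
  refine isPlot_of_nhds fun x => ⟨fun y => ((ε x : ℤˣ) : ℤ) • f y, ?_, ?_⟩
  · rcases Int.units_eq_one_or (ε x) with h | h
    · simpa [h] using hf
    · simpa [h, Function.comp_def] using DiffeologicalAddGroup.smooth_neg n f hf
  · filter_upwards [(IsLocallyConstant.iff_eventually_eq _).1 hε x] with y hy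
    rw [hy]

namespace PlotSections

variable (s : PlotSections P)

lemma proj_eq (z : P.PullbackTotal p.map) : P.proj z.1.2 = P.proj (s.sec p z.1.1) :=
  z.2.trans (s.proj_sec p _).symm

lemma eq_smul_point (z : P.PullbackTotal p.map) : z = P.div (s.proj_eq z) • s.point p z.1.1 :=
  Subtype.ext (Prod.ext rfl (P.eq_div_smul (s.proj_eq z)))

lemma section_ext {m m' : (localSystem P χ M).obj (op p)}
    (h : ∀ x, sectionFun m (s.point p x) = sectionFun m' (s.point p x)) : m = m' :=
  sectionFun_ext fun z => by
    rw [s.eq_smul_point z, sectionFun_smul, sectionFun_smul, h]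

lemma isPlot_point (p : EuclideanPlot X) : IsPlot (s.point p) :=
  ⟨contDiff_id.isPlot, s.isPlot p⟩

lemma exists_section_eq {f : Euc p.dim → M} (hf : IsPlot f) :
    ∃ m : (localSystem P χ M).obj (op p), ∀ x, sectionFun m (s.point p x) = f x := by
  refine ⟨(⟨fun z => ((χ (P.div (s.proj_eq z)).right : ℤˣ) : ℤ) • f z.1.1, fun n r hr => ?_,
    fun h z => ?_⟩ : equivariantFun P χ M p), fun x => ?_⟩
  · have hbase : IsPlot fun u => (r u).1.1 := hr.1
    have hdiv : IsPlot fun u => P.div (s.proj_eq (r u)) :=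
      P.isPlot_div hr.2 (isPlot_reparam (s.isPlot p) hbase.contDiff) _
    exact isPlot_units_smul ((isLocallyConstant_right hdiv).comp χ)
      (isPlot_reparam hf hbase.contDiff)
  · have hmul : P.div (s.proj_eq (h • z)) = h * P.div (s.proj_eq z) := P.div_eq _
      ((congrArg (h • ·) (P.eq_div_smul (s.proj_eq z))).trans (mul_smul _ _ _).symm)
    change ((χ (P.div (s.proj_eq (h • z))).right : ℤˣ) : ℤ) • f z.1.1 = _
    rw [hmul, SemidirectProduct.mul_right, map_mul, Units.val_mul, mul_smul]
  · change ((χ (P.div (s.proj_eq (s.point p x))).right : ℤˣ) : ℤ) • f x = _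
    rw [P.div_eq (s.proj_eq (s.point p x)) (k := 1) (one_smul _ _).symm]
    simp

lemma sec_eq (φ : p ⟶ q) (x : Euc p.dim) :
    s.sec p x = s.transition φ x • s.sec q (φ.toFun x) :=
  P.eq_div_smul _

lemma transition_eq {φ : p ⟶ q} {x : Euc p.dim} {h : HGroup σ}
    (hh : s.sec p x = h • s.sec q (φ.toFun x)) : s.transition φ x = h :=
  P.div_eq _ hh

lemma isPlot_transition (φ : p ⟶ q) : IsPlot (s.transition φ) :=
  P.isPlot_div (s.isPlot p) (isPlot_reparam (s.isPlot q) φ.smooth) _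

lemma transition_comp {r : EuclideanPlot X} (φ : p ⟶ q) (ψ : q ⟶ r) (x : Euc p.dim) :
    s.transition (φ ≫ ψ) x = s.transition φ x * s.transition ψ (φ.toFun x) :=
  s.transition_eq (by rw [mul_smul, s.sec_eq φ, s.sec_eq ψ]; rfl)

lemma sectionFun_map_point (φ : p ⟶ q) (m : (localSystem P χ M).obj (op q)) (x : Euc p.dim) :
    sectionFun ((localSystem P χ M).map φ.op m) (s.point p x) =
      ((χ (s.transition φ x).right : ℤˣ) : ℤ) • sectionFun m (s.point q (φ.toFun x)) := by
  rw [← sectionFun_smul]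
  exact congrArg (sectionFun m) (Subtype.ext (Prod.ext rfl (s.sec_eq φ x)))

/-- The change of trivialization: `s_p = k_p • t_p`. -/
def change (s t : PlotSections P) (p : EuclideanPlot X) (x : Euc p.dim) : HGroup σ :=
  P.div (y := s.sec p x) (z := t.sec p x) ((s.proj_sec p x).trans (t.proj_sec p x).symm)

variable (t : PlotSections P)

lemma isPlot_change (p : EuclideanPlot X) : IsPlot (s.change t p) :=
  P.isPlot_div (s.isPlot p) (t.isPlot p) _

lemma point_eq_change_smul (p : EuclideanPlot X) (x : Euc p.dim) :
    s.point p x = s.change t p x • t.point p x :=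
  Subtype.ext (Prod.ext rfl (P.eq_div_smul _))

lemma transition_mul_change (φ : p ⟶ q) (x : Euc p.dim) :
    s.transition φ x * s.change t q (φ.toFun x) = s.change t p x * t.transition φ x := by
  refine P.smul_right_cancel (z := t.sec q (φ.toFun x)) ?_
  rw [mul_smul, mul_smul, ← t.sec_eq, change, ← P.eq_div_smul, change, ← P.eq_div_smul, ← s.sec_eq]

end PlotSections

end Sections

lemma nonempty_plotSections (P : PrincipalBundle (HGroup σ) X) : Nonempty (PlotSections P) := by
  choose s hs hps using fun p : EuclideanPlot X => P.exists_section p.isPlot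
  exact ⟨⟨s, hs, hps⟩⟩

/-! ### The class `α` -/

lemma exists_isAlpha (P : PrincipalBundle (HGroup σ) X) : ∃ a, IsAlpha P a := by
  obtain ⟨s⟩ := nonempty_plotSections P
  refine ⟨_, s, ⟨fun p q φ => (Additive.ofMul (s.transition φ 0).right : Additive ℤˣ), ?_⟩,
    fun p q φ x => right_eq_right_of_isPlot (s.isPlot_transition φ) x 0, rfl⟩
  refine (d1 (constZ2 X)).mem_ker.2 ?_
  funext p q r φ ψ
  have hcomp : (s.transition (φ ≫ ψ) 0).right =
      (s.transition φ 0).right * (s.transition ψ 0).right := by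
    rw [s.transition_comp, SemidirectProduct.mul_right,
      right_eq_right_of_isPlot (s.isPlot_transition ψ)]
  change Additive.ofMul (s.transition ψ 0).right - Additive.ofMul (s.transition (φ ≫ ψ) 0).right +
    Additive.ofMul (s.transition φ 0).right = 0
  rw [hcomp, ofMul_mul]
  abel

lemma IsAlpha.unique {P : PrincipalBundle (HGroup σ) X} {a b : H1 (constZ2 X)}
    (ha : IsAlpha P a) (hb : IsAlpha P b) : a = b := by
  obtain ⟨s, c, hc, rfl⟩ := ha
  obtain ⟨t, c', hc', rfl⟩ := hb
  let ε : EuclideanPlot X → Additive ℤˣ := fun p => Additive.ofMul (s.change t p 0).right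
  refine mk_eq_mk_H1.2 ⟨ε, ?_⟩
  funext p q φ
  have hchange : (show Additive ℤˣ from c.1 φ) + ε q = ε p + (show Additive ℤˣ from c'.1 φ) := by
    have h := congrArg SemidirectProduct.right (s.transition_mul_change t φ 0)
    rwa [SemidirectProduct.mul_right, SemidirectProduct.mul_right, hc φ 0, hc' φ 0,
      right_eq_right_of_isPlot (s.isPlot_change t q) _ 0] at h
  change ε q - ε p = -(show Additive ℤˣ from c.1 φ) + (show Additive ℤˣ from c'.1 φ)
  rw [sub_eq_iff_eq_add, add_assoc, add_comm _ (ε p), ← hchange, neg_add_cancel_left]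

/-! ### The exponential sequence -/

section Exponential

variable (P : PrincipalBundle (HGroup σ) X) (χ : ℤˣ →* ℤˣ)

/-- A smooth homomorphism of groups of coefficients induces a map of local systems. -/
def localSystemMap {M N : Type*} [AddCommGroup M] [DiffeologicalSpace M] [DiffeologicalAddGroup M]
    [AddCommGroup N] [DiffeologicalSpace N] [DiffeologicalAddGroup N] (θ : M →+ N)
    (hθ : DSmooth θ) :
    CoeffMap (𝟭 (EuclideanPlot X)) (localSystem P χ M) (localSystem P χ N) where
  app p :=
    { toFun := fun (m : equivariantFun P χ M _) => show equivariantFun P χ N p from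
        ⟨fun z => θ (m.1 z), hθ.comp m.2.1, fun h z =>
          (congrArg θ (m.2.2 h z)).trans (map_zsmul θ _ _)⟩
      map_zero' := Subtype.ext (funext fun _ => θ.map_zero)
      map_add' := fun _ _ => Subtype.ext (funext fun _ => θ.map_add _ _) }
  naturality _ _ := rfl

/-- The homomorphism `t ↦ exp (2π i t)` from `ℝ` to `U(1)`. -/
def realToCircle : ℝ →+ Additive Circle where
  toFun t := Additive.ofMul (Circle.exp (2 * Real.pi * t))
  map_zero' := by simp
  map_add' s t := by rw [mul_add, Circle.exp_add, ofMul_mul]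

lemma dSmooth_realToCircle : DSmooth realToCircle :=
  fun _ _ hp => isPlot_circle_exp (contDiff_const.mul hp.contDiff)

lemma dSmooth_intCast : DSmooth (Int.castAddHom ℝ) := fun n p hp => by
  have hp' : IsLocallyConstant p := hp
  refine isPlot_of_nhds fun x => ⟨fun _ => (p x : ℝ), isPlot_const, ?_⟩
  filter_upwards [(IsLocallyConstant.iff_eventually_eq _).1 hp' x] with y hy
  simp [hy]

/-- The map `ℝ_α → U(1)_α` of the exponential sequence. -/
abbrev expMap := localSystemMap P χ realToCircle dSmooth_realToCircle

/-- The map `ℤ_α → ℝ_α` of the exponential sequence. -/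
abbrev castMap := localSystemMap P χ (Int.castAddHom ℝ) dSmooth_intCast

variable {P χ} {p : EuclideanPlot X}

lemma sectionFun_expMap (r : (localSystem P χ ℝ).obj (op p)) (z : P.PullbackTotal p.map) :
    sectionFun ((expMap P χ).app p r) z = realToCircle (sectionFun r z) := rfl

lemma sectionFun_castMap (m : (localSystem P χ ℤ).obj (op p)) (z : P.PullbackTotal p.map) :
    sectionFun ((castMap P χ).app p m) z = (sectionFun m z : ℤ) := rfl

lemma expMap_surjective : Function.Surjective ((expMap P χ).app p) := fun m => by
  obtain ⟨s⟩ := nonempty_plotSections P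
  obtain ⟨r, hr, hrm⟩ := exists_contDiff_circle_lift
    (p := fun x => (sectionFun m (s.point p x)).toMul)
    (dSmooth_sectionFun m _ _ (s.isPlot_point p))
  obtain ⟨r', hr'⟩ := s.exists_section_eq (χ := χ) hr.isPlot
  refine ⟨r', s.section_ext fun x => ?_⟩
  rw [sectionFun_expMap, hr']
  exact hrm x

lemma castMap_injective : Function.Injective ((castMap P χ).app p) := fun m m' h =>
  sectionFun_ext fun z => by
    have hz : sectionFun ((castMap P χ).app p m) z = sectionFun ((castMap P χ).app p m') z := by
      rw [h]
    rw [sectionFun_castMap, sectionFun_castMap] at hz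
    exact_mod_cast hz

lemma expMap_castMap (m : (localSystem P χ ℤ).obj (op p)) :
    (expMap P χ).app p ((castMap P χ).app p m) = 0 :=
  sectionFun_ext fun z => exp_two_pi_eq_one_iff.2 ⟨sectionFun m z, sectionFun_castMap m z⟩

lemma exists_castMap_eq {r : (localSystem P χ ℝ).obj (op p)} (h : (expMap P χ).app p r = 0) :
    ∃ m, (castMap P χ).app p m = r := by
  have hint : ∀ z, ∃ k : ℤ, sectionFun r z = k := fun z => by
    have hz : sectionFun ((expMap P χ).app p r) z = 0 := by rw [h, sectionFun_zero]
    exact exp_two_pi_eq_one_iff.1 hz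
  choose k hk using hint
  have hsmooth : DSmooth k := fun n q hq => by
    have hr : IsPlot (sectionFun r ∘ q) := dSmooth_sectionFun r n q hq
    refine isLocallyConstant_of_continuous_intCast (k := k ∘ q) ?_
    simpa only [Function.comp_def, hk] using hr.contDiff.continuous
  have hequiv : ∀ (h : HGroup σ) z, k (h • z) = ((χ h.right : ℤˣ) : ℤ) • k z := fun h z => by
    have hz := sectionFun_smul r h z
    rw [hk, hk, ← Int.cast_smul_eq_zsmul ℝ, smul_eq_mul] at hz
    exact_mod_cast hz
  exact ⟨(⟨k, hsmooth, hequiv⟩ : equivariantFun P χ ℤ p), sectionFun_ext fun z => (hk z).symm⟩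

variable (P χ) in
lemma isShortExact_exponential : IsShortExact (castMap P χ) (expMap P χ) where
  injective _ := castMap_injective
  exact p r := ⟨exists_castMap_eq, by rintro ⟨m, rfl⟩; exact expMap_castMap m⟩
  surjective _ := expMap_surjective

variable {Ghat : Type*} [Group Ghat] [DiffeologicalSpace Ghat]

lemma isConnecting_iff {E : CircleExtension σ Ghat} {b : H2 (circleSystem E P)}
    {d : H3 (intSystem E P)} :
    IsConnecting E P b d ↔
      IsConnectingClass (castMap P E.character) (expMap P E.character) b d := by
  refine exists_congr fun a => exists_congr fun r => exists_congr fun n =>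
    and_congr ⟨fun h => ?_, fun h => ?_⟩ (and_congr ⟨fun h => ?_, fun h => ?_⟩ Iff.rfl)
  · funext p q s φ ψ
    exact sectionFun_ext fun z => h φ ψ z
  · intro p q s φ ψ z
    rw [← h]
    rfl
  · funext p q s t φ ψ θ
    exact sectionFun_ext fun z => h φ ψ θ z
  · intro p q s t φ ψ θ z
    rw [h]
    rfl

end Exponential

/-! ### Extensions as principal bundles -/

/-- An extension `A → K → L` of diffeological groups, as a principal `A`-bundle over `L`, with `A`
acting on `K` by left translations. -/
def PrincipalBundle.ofExtension {A K L : Type*} [Group A] [DiffeologicalSpace A] [Group K]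
    [DiffeologicalSpace K] [DiffeologicalGroup K] [Group L] [DiffeologicalSpace L] (ι : A →* K)
    (π : K →* L) (hinj : Function.Injective ι)
    (hind : ∀ (n : ℕ) (z : Euc n → A), IsPlot z ↔ IsPlot (ι ∘ z)) (hπ : IsSubduction π)
    (hrange : ι.range = π.ker) : PrincipalBundle A L where
  Total := K
  action := MulAction.compHom K ι
  proj := π
  subduction := hπ
  proj_smul a k := by
    have ha : π (ι a) = 1 := MonoidHom.mem_ker.1 (hrange ▸ ⟨a, rfl⟩)
    change π (ι a * k) = π k
    rw [map_mul, ha, one_mul]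
  smooth_smul n p hp := IsPlot.mul' ((hind n _).1 hp.1) hp.2
  free_transitive k l h := by
    have hker : k * l⁻¹ ∈ π.ker := by
      rw [MonoidHom.mem_ker, map_mul, map_inv, h, mul_inv_cancel]
    obtain ⟨a, ha⟩ : k * l⁻¹ ∈ ι.range := hrange ▸ hker
    exact ⟨a, eq_mul_of_mul_inv_eq ha.symm, fun b (hb : k = ι b * l) =>
      hinj (by rw [ha, hb, mul_inv_cancel_right])⟩
  smooth_div n a z hz haz := by
    have ha : IsPlot fun x => ι (a x) * z x * (z x)⁻¹ := IsPlot.mul' haz (IsPlot.inv' hz)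
    exact (hind n a).2 (by simpa only [mul_inv_cancel_right, Function.comp_def] using ha)

lemma isPlot_mulAut_apply {τ : ℤˣ →* MulAut G} (hτ : ∀ ε, DSmooth (τ ε)) {n : ℕ} {ε : Euc n → ℤˣ}
    (hε : IsLocallyConstant ε) {g : Euc n → G} (hg : IsPlot g) :
    IsPlot fun x => τ (ε x) (g x) := by
  refine isPlot_of_nhds fun x => ⟨_, hτ (ε x) n g hg, ?_⟩
  filter_upwards [(IsLocallyConstant.iff_eventually_eq _).1 hε x] with y hy
  rw [hy]
  rfl

lemma diffeologicalGroup_hGroup [DiffeologicalGroup G] (hσ : ∀ ε, DSmooth (σ ε)) :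
    DiffeologicalGroup (HGroup σ) where
  smooth_mul _ _ hp :=
    ⟨IsPlot.mul' (isPlot_left hp.1) (isPlot_mulAut_apply hσ (isLocallyConstant_right hp.1)
      (isPlot_left hp.2)), (isLocallyConstant_right hp.1).mul (isLocallyConstant_right hp.2)⟩
  smooth_inv _ _ hp :=
    ⟨isPlot_mulAut_apply hσ (isLocallyConstant_right hp).inv (IsPlot.inv' (isPlot_left hp)),
      (isLocallyConstant_right hp).inv⟩

/-! ### The extension of `H_σ` by `U(1)` -/

namespace CircleExtension

variable {Ghat : Type*} [Group Ghat] [DiffeologicalSpace Ghat] (E : CircleExtension σ Ghat)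

lemma quot_incl (z : Circle) : E.quot (E.incl z) = 1 :=
  MonoidHom.mem_ker.1 (E.range_incl ▸ ⟨z, rfl⟩)

lemma exists_incl_eq {g : Ghat} (h : E.quot g = 1) : ∃ z, E.incl z = g :=
  MonoidHom.mem_range.1 (E.range_incl ▸ h)

lemma incl_mul_comm (z : Circle) (g : Ghat) : E.incl z * g = g * E.incl z :=
  (Subgroup.mem_center_iff.1 (E.central ⟨z, rfl⟩) g).symm

lemma exists_act_incl_eq (ε : ℤˣ) :
    ∃ θ : Circle →* Circle, ∀ z, E.act ε (E.incl z) = E.incl (θ z) := by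
  choose θ hθ using fun z : Circle =>
    E.exists_incl_eq (g := E.act ε (E.incl z)) (by rw [E.quot_act, quot_incl, map_one])
  exact ⟨{ toFun := θ
           map_one' := E.incl_injective (by simp only [hθ, map_one])
           map_mul' := fun z w => E.incl_injective (by simp only [hθ, map_mul]) },
    fun z => (hθ z).symm⟩

lemma act_neg_one_incl :
    (∀ z, E.act (-1) (E.incl z) = E.incl z) ∨ ∀ z, E.act (-1) (E.incl z) = E.incl z⁻¹ := by
  obtain ⟨θ, hθ⟩ := E.exists_act_incl_eq (-1)
  have hsmooth : DSmooth θ := fun n p hp => (E.incl_induction n _).2 <| by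
    have h : E.act (-1) ∘ E.incl ∘ p = E.incl ∘ θ ∘ p := funext fun x => hθ (p x)
    exact h ▸ E.act_smooth (-1) n _ ((E.incl_induction n _).1 hp)
  have hinv : Function.Involutive θ := fun z => E.incl_injective <| by
    rw [← hθ, ← hθ, ← MulAut.mul_apply, ← map_mul, neg_one_mul, neg_neg, map_one,
      MulAut.one_apply]
  exact (eq_id_or_eq_inv_of_involutive (continuous_of_dSmooth_circle hsmooth) hinv).imp
    (fun h z => by rw [hθ, h]) fun h z => by rw [hθ, h]

lemma act_incl (ε : ℤˣ) (z : Circle) :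
    E.act ε (E.incl z) = E.incl (z ^ ((E.character ε : ℤˣ) : ℤ)) := by
  by_cases h : ∀ ε z, E.act ε (E.incl z) = E.incl z
  · rw [character, if_pos h, h, MonoidHom.one_apply, Units.val_one, zpow_one]
  rw [character, if_neg h, MonoidHom.id_apply]
  rcases Int.units_eq_one_or ε with rfl | rfl
  · rw [map_one, MulAut.one_apply, Units.val_one, zpow_one]
  rcases E.act_neg_one_incl with htriv | hinv
  · refine absurd (fun ε z => ?_) h
    rcases Int.units_eq_one_or ε with rfl | rfl
    · rw [map_one, MulAut.one_apply]
    · exact htriv z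
  · rw [hinv, Units.val_neg, Units.val_one, zpow_neg_one]

/-- The projection `Ĝ ⋊ ℤ₂ → G ⋊ ℤ₂`. -/
def quotHat : HGroup E.act →* HGroup σ :=
  SemidirectProduct.map E.quot (MonoidHom.id _) fun ε => MonoidHom.ext fun g => E.quot_act ε g

/-- The inclusion `U(1) → Ĝ ⋊ ℤ₂`, whose image is not central if the character is nontrivial. -/
def inclHat : Circle →* HGroup E.act :=
  SemidirectProduct.inl.comp E.incl

lemma quotHat_eq_iff {k : HGroup E.act} {h : HGroup σ} :
    E.quotHat k = h ↔ E.quot k.left = h.left ∧ k.right = h.right :=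
  SemidirectProduct.ext_iff

lemma inclHat_injective : Function.Injective E.inclHat :=
  SemidirectProduct.inl_injective.comp E.incl_injective

lemma mul_inclHat (k : HGroup E.act) (z : Circle) :
    k * E.inclHat z = E.inclHat (z ^ ((E.character k.right : ℤˣ) : ℤ)) * k := by
  refine SemidirectProduct.ext ?_ ((mul_one _).trans (one_mul _).symm)
  calc k.left * E.act k.right (E.incl z)
      = E.incl (z ^ ((E.character k.right : ℤˣ) : ℤ)) * k.left := by
        rw [E.act_incl, ← E.incl_mul_comm]
    _ = E.incl (z ^ ((E.character k.right : ℤˣ) : ℤ)) * E.act 1 k.left := by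
        rw [map_one, MulAut.one_apply]

lemma isPlot_inclHat_iff (n : ℕ) (z : Euc n → Circle) : IsPlot z ↔ IsPlot (E.inclHat ∘ z) :=
  (E.incl_induction n z).trans ⟨fun h => ⟨h, isPlot_const⟩, fun h => isPlot_left h⟩

lemma isSubduction_quotHat : IsSubduction E.quotHat where
  smooth _ _ hp :=
    have hright := isLocallyConstant_right hp
    ⟨E.quot_subduction.smooth _ _ (isPlot_left hp), hright⟩
  surjective h := by
    obtain ⟨g, hg⟩ := E.quot_subduction.surjective h.left
    exact ⟨⟨g, h.right⟩, E.quotHat_eq_iff.2 ⟨hg, rfl⟩⟩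
  lifts n p hp x := by
    obtain ⟨q, hq, hpq⟩ := E.quot_subduction.lifts n _ (isPlot_left hp) x
    refine ⟨fun y => ⟨q y, (p y).right⟩, ⟨hq, isLocallyConstant_right hp⟩, ?_⟩
    filter_upwards [hpq] with y hy
    exact SemidirectProduct.ext hy rfl

lemma range_inclHat : E.inclHat.range = E.quotHat.ker := by
  ext k
  rw [MonoidHom.mem_ker, quotHat_eq_iff]
  constructor
  · rintro ⟨z, rfl⟩
    exact ⟨E.quot_incl z, rfl⟩
  · rintro ⟨hleft, hright⟩
    obtain ⟨z, hz⟩ := E.exists_incl_eq hleft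
    exact ⟨z, SemidirectProduct.ext hz hright.symm⟩

variable {E}

lemma cocycle_identity {k₁ k₂ k₃ k₁₂ k₂₃ k₁₂₃ : HGroup E.act} {a b c d : Additive Circle}
    (h₁₂ : k₁ * k₂ = E.inclHat a.toMul * k₁₂) (h₂₃ : k₂ * k₃ = E.inclHat b.toMul * k₂₃)
    (hl : k₁ * k₂₃ = E.inclHat c.toMul * k₁₂₃) (hr : k₁₂ * k₃ = E.inclHat d.toMul * k₁₂₃) :
    ((E.character k₁.right : ℤˣ) : ℤ) • b + c = a + d := by
  set χ : ℤ := ((E.character k₁.right : ℤˣ) : ℤ)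
  refine Additive.toMul.injective (E.inclHat_injective (mul_right_cancel (b := k₁₂₃) ?_))
  calc E.inclHat (b.toMul ^ χ * c.toMul) * k₁₂₃
      = E.inclHat (b.toMul ^ χ) * (k₁ * k₂₃) := by rw [map_mul, mul_assoc, hl]
    _ = k₁ * (E.inclHat b.toMul * k₂₃) := by rw [← mul_assoc, ← E.mul_inclHat, mul_assoc]
    _ = k₁ * k₂ * k₃ := by rw [← h₂₃, mul_assoc]
    _ = E.inclHat (a.toMul * d.toMul) * k₁₂₃ := by rw [h₁₂, mul_assoc, hr, map_mul, mul_assoc]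

lemma coboundary_identity {k₁ k₂ k₁₂ l₁ l₂ l₁₂ u₁ u₂ u₃ : HGroup E.act}
    {a a' e₁ e₂ e₁₂ : Additive Circle} (hk : k₁ * k₂ = E.inclHat a.toMul * k₁₂)
    (hl : l₁ * l₂ = E.inclHat a'.toMul * l₁₂) (h₁ : l₁ * u₂ = E.inclHat e₁.toMul * (u₁ * k₁))
    (h₂ : l₂ * u₃ = E.inclHat e₂.toMul * (u₂ * k₂))
    (h₁₂ : l₁₂ * u₃ = E.inclHat e₁₂.toMul * (u₁ * k₁₂)) :
    a' + e₁₂ = ((E.character l₁.right : ℤˣ) : ℤ) • e₂ +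
      (e₁ + ((E.character u₁.right : ℤˣ) : ℤ) • a) := by
  set χ : ℤ := ((E.character l₁.right : ℤˣ) : ℤ)
  set χ' : ℤ := ((E.character u₁.right : ℤˣ) : ℤ)
  refine Additive.toMul.injective (E.inclHat_injective (mul_right_cancel (b := u₁ * k₁₂) ?_))
  calc E.inclHat (a'.toMul * e₁₂.toMul) * (u₁ * k₁₂)
      = l₁ * (l₂ * u₃) := by rw [map_mul, mul_assoc, ← h₁₂, ← mul_assoc, ← hl, mul_assoc]
    _ = E.inclHat (e₂.toMul ^ χ) * (l₁ * u₂ * k₂) := by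
        rw [h₂, ← mul_assoc, E.mul_inclHat, mul_assoc, mul_assoc l₁]
    _ = E.inclHat (e₂.toMul ^ χ) *
          (E.inclHat e₁.toMul * (u₁ * (E.inclHat a.toMul * k₁₂))) := by
        rw [h₁, ← hk, mul_assoc, mul_assoc u₁]
    _ = E.inclHat (e₂.toMul ^ χ * (e₁.toMul * a.toMul ^ χ')) * (u₁ * k₁₂) := by
        rw [← mul_assoc u₁, E.mul_inclHat]
        simp only [map_mul, mul_assoc, χ']

variable [DiffeologicalGroup Ghat]

instance : DiffeologicalGroup (HGroup E.act) :=
  diffeologicalGroup_hGroup E.act_smooth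

variable (E)

/-- The extension `Ĝ ⋊ ℤ₂` of `H_σ` by `U(1)`, as a principal `U(1)`-bundle. -/
def circleBundle : PrincipalBundle Circle (HGroup σ) :=
  .ofExtension E.inclHat E.quotHat E.inclHat_injective E.isPlot_inclHat_iff E.isSubduction_quotHat
    E.range_inclHat

lemma exists_lift {n : ℕ} {h : Euc n → HGroup σ} (hh : IsPlot h) :
    ∃ k : Euc n → HGroup E.act, IsPlot k ∧ ∀ x, E.quotHat (k x) = h x :=
  E.circleBundle.exists_section hh

variable {E}

lemma exists_eq_inclHat_mul {n : ℕ} {k l : Euc n → HGroup E.act} (hk : IsPlot k) (hl : IsPlot l)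
    (h : ∀ x, E.quotHat (k x) = E.quotHat (l x)) :
    ∃ z : Euc n → Circle, IsPlot z ∧ ∀ x, k x = E.inclHat (z x) * l x :=
  ⟨_, E.circleBundle.isPlot_div hk hl h, fun x => E.circleBundle.eq_div_smul (h x)⟩

variable {P : PrincipalBundle (HGroup σ) X} {p : EuclideanPlot X}

lemma exists_section_eq_inclHat_mul (s : PlotSections P) {k l : Euc p.dim → HGroup E.act}
    (hk : IsPlot k) (hl : IsPlot l) (h : ∀ x, E.quotHat (k x) = E.quotHat (l x)) :
    ∃ m : (circleSystem E P).obj (op p),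
      ∀ x, k x = E.inclHat (sectionFun m (s.point p x)).toMul * l x := by
  obtain ⟨z, hz, hkl⟩ := exists_eq_inclHat_mul hk hl h
  obtain ⟨m, hm⟩ := s.exists_section_eq (χ := E.character) (M := Additive Circle)
    (f := fun x => Additive.ofMul (z x)) hz
  exact ⟨m, fun x => by rw [hm, toMul_ofMul, hkl]⟩

end CircleExtension

/-! ### The class `β` -/

section Beta

variable {Ghat : Type*} [Group Ghat] [DiffeologicalSpace Ghat] {E : CircleExtension σ Ghat}
  {P : PrincipalBundle (HGroup σ) X}

namespace LiftingData

variable (L : LiftingData E P) {p q r : EuclideanPlot X}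

/-- The lift `(ĝ_φ, ε_φ)` of the transition function to `Ĝ ⋊ ℤ₂`. -/
def hat (φ : p ⟶ q) (x : Euc p.dim) : HGroup E.act :=
  ⟨L.lift φ x, (L.transition φ x).right⟩

lemma quotHat_hat (φ : p ⟶ q) (x : Euc p.dim) : E.quotHat (L.hat φ x) = L.transition φ x :=
  E.quotHat_eq_iff.2 ⟨L.quot_lift φ x, rfl⟩

lemma isPlot_hat (φ : p ⟶ q) : IsPlot (L.hat φ) :=
  have hright := isLocallyConstant_right (L.isPlot_transition φ)
  ⟨L.isPlot_lift φ, hright⟩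

lemma incl_eq_iff (φ : p ⟶ q) (ψ : q ⟶ r) (x : Euc p.dim) (z : Circle) :
    E.incl z = L.lift φ x * E.act (L.transition φ x).right (L.lift ψ (φ.toFun x)) *
        (L.lift (φ ≫ ψ) x)⁻¹ ↔
      L.hat φ x * L.hat ψ (φ.toFun x) = E.inclHat z * L.hat (φ ≫ ψ) x := by
  rw [eq_mul_inv_iff_mul_eq, SemidirectProduct.ext_iff, eq_comm, hat, hat, hat]
  simp [CircleExtension.inclHat, L.transition_comp]

end LiftingData

/-- `a` has the coordinates `a_{φ,ψ}` of the paper in the trivialization and the lifts of `L`; the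
equation takes place in `Ĝ ⋊ ℤ₂`, where the products of the lifts are untwisted. -/
def IsBetaCochain (L : LiftingData E P) (a : C2 (circleSystem E P)) : Prop :=
  ∀ ⦃p q r : EuclideanPlot X⦄ (φ : p ⟶ q) (ψ : q ⟶ r) (x : Euc p.dim),
    L.hat φ x * L.hat ψ (φ.toFun x) =
      E.inclHat (sectionFun (a φ ψ) (L.point p x)).toMul * L.hat (φ ≫ ψ) x

lemma isBeta_iff {b : H2 (circleSystem E P)} :
    IsBeta E P b ↔ ∃ (L : LiftingData E P) (a : (d2 (circleSystem E P)).ker),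
      IsBetaCochain L a.1 ∧ b = QuotientAddGroup.mk a := by
  refine exists_congr fun L => exists_congr fun a => and_congr ?_ Iff.rfl
  exact forall₃_congr fun p q r => forall₃_congr fun φ ψ x => L.incl_eq_iff φ ψ x _

lemma IsBetaCochain.d2_eq_zero {L : LiftingData E P} {a : C2 (circleSystem E P)}
    (ha : IsBetaCochain L a) : d2 _ a = 0 := by
  funext p q r s φ ψ θ
  refine L.section_ext fun x => ?_
  have hr : L.hat (φ ≫ ψ) x * L.hat θ (ψ.toFun (φ.toFun x)) =
      E.inclHat (sectionFun (a (φ ≫ ψ) θ) (L.point p x)).toMul * L.hat (φ ≫ ψ ≫ θ) x :=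
    ha (φ ≫ ψ) θ x
  have hcocycle : ((E.character (L.transition φ x).right : ℤˣ) : ℤ) •
      sectionFun (a ψ θ) (L.point q (φ.toFun x)) + sectionFun (a φ (ψ ≫ θ)) (L.point p x) =
        sectionFun (a φ ψ) (L.point p x) + sectionFun (a (φ ≫ ψ) θ) (L.point p x) :=
    CircleExtension.cocycle_identity (k₁ := L.hat φ x) (ha φ ψ x) (ha ψ θ (φ.toFun x))
      (ha φ (ψ ≫ θ) x) hr
  change sectionFun ((circleSystem E P).map φ.op (a ψ θ) - a (φ ≫ ψ) θ + a φ (ψ ≫ θ) - a φ ψ) _ = 0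
  rw [sectionFun_sub, sectionFun_add, sectionFun_sub, L.sectionFun_map_point, sub_add_eq_add_sub,
    hcocycle, add_sub_cancel_right, sub_self]

variable [DiffeologicalGroup Ghat]

lemma nonempty_liftingData (E : CircleExtension σ Ghat) (P : PrincipalBundle (HGroup σ) X) :
    Nonempty (LiftingData E P) := by
  obtain ⟨s⟩ := nonempty_plotSections P
  choose k hk hks using fun (p q : EuclideanPlot X) (φ : p ⟶ q) =>
    E.exists_lift (s.isPlot_transition φ)
  exact ⟨{ s with
    lift := fun p q φ x => (k p q φ x).left
    isPlot_lift := fun p q φ => isPlot_left (hk p q φ)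
    quot_lift := fun p q φ x => (E.quotHat_eq_iff.1 (hks p q φ x)).1 }⟩

lemma exists_isBetaCochain (L : LiftingData E P) : ∃ a, IsBetaCochain L a := by
  choose a ha using fun (p q r : EuclideanPlot X) (φ : p ⟶ q) (ψ : q ⟶ r) =>
    CircleExtension.exists_section_eq_inclHat_mul L.toPlotSections
      (IsPlot.mul' (L.isPlot_hat φ) (isPlot_reparam (L.isPlot_hat ψ) φ.smooth))
      (L.isPlot_hat (φ ≫ ψ)) fun x => by
        rw [map_mul, Function.comp_apply, L.quotHat_hat, L.quotHat_hat, L.quotHat_hat,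
          L.transition_comp]
  exact ⟨a, ha⟩

lemma exists_isBeta (E : CircleExtension σ Ghat) (P : PrincipalBundle (HGroup σ) X) :
    ∃ b, IsBeta E P b := by
  obtain ⟨L⟩ := nonempty_liftingData E P
  obtain ⟨a, ha⟩ := exists_isBetaCochain L
  exact ⟨_, isBeta_iff.2 ⟨L, ⟨a, ha.d2_eq_zero⟩, ha, rfl⟩⟩

lemma IsBetaCochain.exists_d1_eq {L L' : LiftingData E P} {a a' : C2 (circleSystem E P)}
    (ha : IsBetaCochain L a) (ha' : IsBetaCochain L' a') : ∃ e, d1 _ e = -a + a' := by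
  choose u hu hchange using fun p : EuclideanPlot X =>
    E.exists_lift (L'.isPlot_change L.toPlotSections p)
  choose e he using fun (p q : EuclideanPlot X) (φ : p ⟶ q) =>
    CircleExtension.exists_section_eq_inclHat_mul L'.toPlotSections
      (IsPlot.mul' (L'.isPlot_hat φ) (isPlot_reparam (hu q) φ.smooth))
      (IsPlot.mul' (hu p) (L.isPlot_hat φ)) fun x => by
        rw [map_mul, map_mul, Function.comp_apply, L.quotHat_hat, L'.quotHat_hat, hchange, hchange,
          L'.transition_mul_change L.toPlotSections]
  refine ⟨e, ?_⟩
  funext p q r φ ψ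
  refine L'.section_ext fun x => ?_
  have h₁₂ : L'.hat (φ ≫ ψ) x * u r (ψ.toFun (φ.toFun x)) =
      E.inclHat (sectionFun (e p r (φ ≫ ψ)) (L'.point p x)).toMul * (u p x * L.hat (φ ≫ ψ) x) :=
    he p r (φ ≫ ψ) x
  have hcoboundary : sectionFun (a' φ ψ) (L'.point p x) +
      sectionFun (e p r (φ ≫ ψ)) (L'.point p x) =
        ((E.character (L'.transition φ x).right : ℤˣ) : ℤ) •
          sectionFun (e q r ψ) (L'.point q (φ.toFun x)) +
        (sectionFun (e p q φ) (L'.point p x) +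
          ((E.character (u p x).right : ℤˣ) : ℤ) • sectionFun (a φ ψ) (L.point p x)) :=
    CircleExtension.coboundary_identity (l₁ := L'.hat φ x) (u₁ := u p x) (ha φ ψ x) (ha' φ ψ x)
      (he p q φ x) (he q r ψ (φ.toFun x)) h₁₂
  have hpoint : sectionFun (a φ ψ) (L'.point p x) =
      ((E.character (u p x).right : ℤˣ) : ℤ) • sectionFun (a φ ψ) (L.point p x) := by
    rw [L'.point_eq_change_smul L.toPlotSections, sectionFun_smul,
      (E.quotHat_eq_iff.1 (hchange p x)).2]
  change sectionFun ((circleSystem E P).map φ.op (e q r ψ) - e p r (φ ≫ ψ) + e p q φ) _ =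
    sectionFun (-a φ ψ + a' φ ψ) _
  rw [sectionFun_add, sectionFun_sub, sectionFun_add, sectionFun_neg, L'.sectionFun_map_point,
    hpoint, sub_add_eq_add_sub, sub_eq_iff_eq_add, add_assoc, hcoboundary]
  abel

lemma IsBeta.unique {b b' : H2 (circleSystem E P)} (hb : IsBeta E P b) (hb' : IsBeta E P b') :
    b = b' := by
  obtain ⟨L, a, ha, rfl⟩ := isBeta_iff.1 hb
  obtain ⟨L', a', ha', rfl⟩ := isBeta_iff.1 hb'
  exact mk_eq_mk_H2.2 (ha.exists_d1_eq ha')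

/-! ### The twisting datum -/

theorem existsUnique_isTwistingDatum (E : CircleExtension σ Ghat)
    (P : PrincipalBundle (HGroup σ) X) : ∃! t, IsTwistingDatum E P t := by
  have hexp := isShortExact_exponential P E.character
  obtain ⟨a, ha⟩ := exists_isAlpha P
  obtain ⟨b, hb⟩ := exists_isBeta E P
  obtain ⟨d, hd⟩ := hexp.exists_isConnectingClass b
  refine ⟨(a, d), ⟨ha, b, hb, isConnecting_iff.2 hd⟩, ?_⟩
  rintro ⟨a', d'⟩ ⟨ha', b', hb', hd'⟩
  obtain rfl := hb'.unique hb
  exact Prod.ext (ha'.unique ha) (hexp.isConnectingClass_unique (isConnecting_iff.1 hd') hd)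

lemma isTwistingDatum_twistingDatum (E : CircleExtension σ Ghat)
    (P : PrincipalBundle (HGroup σ) X) : IsTwistingDatum E P (twistingDatum E P) :=
  Classical.epsilon_spec (existsUnique_isTwistingDatum E P).exists

end Beta

/-! ### Naturality -/

section Naturality

variable {Ghat : Type*} [Group Ghat] [DiffeologicalSpace Ghat] {E : CircleExtension σ Ghat}
  {P : PrincipalBundle (HGroup σ) X} {Q : PrincipalBundle (HGroup σ) Y} {f : X → Y}
  {hf : DSmooth f} (Φ : P.Iso (Q.pullback f hf))

namespace PlotSections

variable (s : PlotSections Q) {p q : EuclideanPlot X}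

/-- The point `(p(x), s_{f ∘ p}(x))` of the pull-back of `Q` along `f`. -/
def pullbackPoint (hf : DSmooth f) (p : EuclideanPlot X) (x : Euc p.dim) :
    (Q.pullback f hf).Total :=
  (⟨(p.map x, s.sec ((EuclideanPlot.push f hf).obj p) x),
    s.proj_sec ((EuclideanPlot.push f hf).obj p) x⟩ : Q.PullbackTotal f)

lemma isPlot_pullbackPoint (hf : DSmooth f) (p : EuclideanPlot X) :
    IsPlot (s.pullbackPoint hf p) :=
  (show _ ∧ _ from ⟨p.isPlot, s.isPlot ((EuclideanPlot.push f hf).obj p)⟩)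

/-- The trivialization of `P ≅ f^*Q` induced by a trivialization of `Q`. -/
def pull : PlotSections P where
  sec p x := Φ.toEquiv.symm (s.pullbackPoint hf p x)
  isPlot p := Φ.smooth_invFun _ _ (s.isPlot_pullbackPoint hf p)
  proj_sec p x := by
    rw [← Φ.proj_comp, Equiv.apply_symm_apply]
    rfl

lemma toEquiv_pull_sec (p : EuclideanPlot X) (x : Euc p.dim) :
    Φ.toEquiv ((s.pull Φ).sec p x) = s.pullbackPoint hf p x :=
  Φ.toEquiv.apply_symm_apply _

lemma pull_transition (φ : p ⟶ q) (x : Euc p.dim) :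
    (s.pull Φ).transition φ x = s.transition ((EuclideanPlot.push f hf).map φ) x := by
  refine (s.pull Φ).transition_eq (Φ.toEquiv.injective ?_)
  rw [Φ.equivariant, toEquiv_pull_sec, toEquiv_pull_sec]
  exact Subtype.ext (Prod.ext (φ.comm x).symm (s.sec_eq ((EuclideanPlot.push f hf).map φ) x))

lemma sectionFun_localSystemPull_point {χ : ℤˣ →* ℤˣ} {M : Type*} [AddCommGroup M]
    [DiffeologicalSpace M] [DiffeologicalAddGroup M]
    (m : (localSystem Q χ M).obj (op ((EuclideanPlot.push f hf).obj p))) (x : Euc p.dim) :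
    sectionFun ((localSystemPull f hf Φ χ M).app p m) ((s.pull Φ).point p x) =
      sectionFun m (s.point _ x) :=
  congrArg (sectionFun m) (Subtype.ext (Prod.ext rfl
    (congrArg (fun z : Q.PullbackTotal f => z.1.2) (s.toEquiv_pull_sec Φ p x))))

end PlotSections

/-- The lifts of the transition functions of `P ≅ f^*Q` induced by those of `Q`. -/
def LiftingData.pull (L : LiftingData E Q) : LiftingData E P where
  toPlotSections := L.toPlotSections.pull Φ
  lift _ _ φ := L.lift ((EuclideanPlot.push f hf).map φ)
  isPlot_lift _ _ φ := L.isPlot_lift ((EuclideanPlot.push f hf).map φ)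
  quot_lift _ _ φ x := by
    rw [L.toPlotSections.pull_transition Φ]
    exact L.quot_lift ((EuclideanPlot.push f hf).map φ) x

lemma LiftingData.pull_hat (L : LiftingData E Q) {p q : EuclideanPlot X} (φ : p ⟶ q)
    (x : Euc p.dim) : (L.pull Φ).hat φ x = L.hat ((EuclideanPlot.push f hf).map φ) x :=
  have hright := congrArg SemidirectProduct.right (L.toPlotSections.pull_transition Φ φ x)
  SemidirectProduct.ext rfl hright

lemma IsAlpha.pull (Φ : P.Iso (Q.pullback f hf)) {a : H1 (constZ2 Y)} (ha : IsAlpha Q a) :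
    IsAlpha P ((z2Pull f hf).mapH1 a) := by
  obtain ⟨s, c, hc, rfl⟩ := ha
  exact ⟨s.pull Φ, _, fun p q φ x =>
    (congrArg SemidirectProduct.right (s.pull_transition Φ φ x)).trans
      (hc ((EuclideanPlot.push f hf).map φ) x), rfl⟩

lemma IsBetaCochain.pull {L : LiftingData E Q} {a : C2 (circleSystem E Q)}
    (ha : IsBetaCochain L a) :
    IsBetaCochain (L.pull Φ) ((localSystemPull f hf Φ E.character (Additive Circle)).pull2 a) :=
  fun p q r φ ψ x => by
    have hsection := L.toPlotSections.sectionFun_localSystemPull_point Φ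
      (a ((EuclideanPlot.push f hf).map φ) ((EuclideanPlot.push f hf).map ψ)) x
    rw [L.pull_hat, L.pull_hat, L.pull_hat]
    exact (ha ((EuclideanPlot.push f hf).map φ) ((EuclideanPlot.push f hf).map ψ) x).trans
      (congrArg (fun z : Additive Circle => E.inclHat z.toMul * _) hsection.symm)

lemma IsBeta.pull {b : H2 (circleSystem E Q)} (hb : IsBeta E Q b) :
    IsBeta E P ((localSystemPull f hf Φ E.character (Additive Circle)).mapH2 b) := by
  obtain ⟨L, a, ha, rfl⟩ := isBeta_iff.1 hb
  exact isBeta_iff.2 ⟨L.pull Φ, _, ha.pull Φ, rfl⟩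

lemma IsConnecting.pull {b : H2 (circleSystem E Q)} {d : H3 (intSystem E Q)}
    (h : IsConnecting E Q b d) :
    IsConnecting E P ((localSystemPull f hf Φ E.character (Additive Circle)).mapH2 b)
      ((localSystemPull f hf Φ E.character ℤ).mapH3 d) := by
  obtain ⟨a, r, n, har, hrn, rfl, rfl⟩ := h
  refine ⟨_, (localSystemPull f hf Φ E.character ℝ).pull2 r, _, fun p q s φ ψ z => ?_,
    fun p q s t φ ψ θ z => ?_, rfl, rfl⟩
  · exact har ((EuclideanPlot.push f hf).map φ) ((EuclideanPlot.push f hf).map ψ) _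
  · rw [CoeffMap.d2_pull]
    exact hrn ((EuclideanPlot.push f hf).map φ) ((EuclideanPlot.push f hf).map ψ)
      ((EuclideanPlot.push f hf).map θ) _

lemma IsTwistingDatum.pull {t : TwistGroup E Q} (h : IsTwistingDatum E Q t) :
    IsTwistingDatum E P (twistPull E f hf Φ t) := by
  obtain ⟨ha, b, hb, hd⟩ := h
  exact ⟨ha.pull Φ, _, hb.pull Φ, hd.pull Φ⟩

end Naturality

end SphericalTwist

end

theorem mainTheorem9_general {G : Type*} [Group G] [DiffeologicalSpace G] {σ : ℤˣ →* MulAut G}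
    {Ghat : Type*} [Group Ghat] [DiffeologicalSpace Ghat] [DiffeologicalGroup Ghat]
    (E : CircleExtension σ Ghat)
    {X : Type*} [DiffeologicalSpace X] (P : PrincipalBundle (HGroup σ) X)
    {Y : Type*} [DiffeologicalSpace Y] (Q : PrincipalBundle (HGroup σ) Y)
    (f : X → Y) (hf : DSmooth f) (Φ : P.Iso (Q.pullback f hf)) :
    (∃! t, IsTwistingDatum E Q t) ∧
      (∃! t, IsTwistingDatum E P t) ∧
      twistingDatum E P = twistPull E f hf Φ (twistingDatum E Q) :=
  have hP := existsUnique_isTwistingDatum E P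
  have hpull := (isTwistingDatum_twistingDatum E Q).pull Φ
  ⟨existsUnique_isTwistingDatum E Q, hP, hP.unique (isTwistingDatum_twistingDatum E P) hpull⟩

theorem mainTheorem9 {G : Type*} [Group G] [DiffeologicalSpace G] [DiffeologicalGroup G]
    (σ : ℤˣ →* MulAut G) (hσ : ∀ ε, DSmooth (σ ε))
    {Ghat : Type*} [Group Ghat] [DiffeologicalSpace Ghat] [DiffeologicalGroup Ghat]
    (E : CircleExtension σ Ghat)
    {X : Type*} [DiffeologicalSpace X] (P : PrincipalBundle (HGroup σ) X)
    (f : X → BSph σ) (hf : DSmooth f) (Φ : P.Iso ((universalBundle σ hσ).pullback f hf)) :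
    (∃! t, IsTwistingDatum E (universalBundle σ hσ) t) ∧
      (∃! t, IsTwistingDatum E P t) ∧
      twistingDatum E P = twistPull E f hf Φ (twistingDatum E (universalBundle σ hσ)) :=
  mainTheorem9_general E P (universalBundle σ hσ) f hf Φ
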